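/- **Setting.** Let $K_a,K_d\in\mathbb N$, $\sigma>0$, $\mathcal A_a>0$ and $\mathcal P_1,\dots,\mathcal P_{K_d},\mathcal A_1,\dots,\mathcal A_{K_d}>0$. In each channel use the Gaussian multiple access channel maps the real inputs of the transmitters to their sum plus independent noise distributed as $\mathcal N(0,\sigma^2)$. Logarithms are natural. A *scheme* of block length $n$ consists of numbers $L, M_1,\dots,M_{K_d}$, analog encoders $\mathcal E_k:[-1,1]^L\to\mathbb R^n$ ($k\le K_a$), digital encoders $\mathcal F_k:\{1,\dots,M_k\}\to\mathbb R^n$ ($k\le K_d$) and a decoder that maps the channel output $Y^n$ to message estimates $\hat m_1,\dots,\hat m_{K_d}$ and real numbers $\hat f_1,\dots,\hat f_L$. Its digital rates are $\log(M_k)/n$ and its analog rate is $L/n$. Digital rates $R=(R_1,\dots,R_{K_d})\in[0,\infty)^{K_d}$, analog rate $\beta$ and analog error $V$ are *achievable* if there is a scheme for each block length $n\ge1$ such that 1. for every $n$, the digital rates are at least $R_1,\dots,R_{K_d}$ and the analog rate is at least $\beta$; 2. for every $n$, $\|\mathcal E_k(s)\|_\infty\le\mathcal A_a$, $\|\mathcal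 F_k(m)\|_\infty\le\mathcal A_k$ and $\frac1n\|\mathcal F_k(m)\|_2^2\le\mathcal P_k$ for all transmitters $k$, all $s\in[-1,1]^L$ and all messages $m$; 3. the probability that some message estimate is wrong, under independent uniform messages, tends to $0$ as $n\to\infty$, uniformly in the analog values; 4. for all except finitely many $n$, $\mathbb E\big[(s_{1,\ell}+\dots+s_{K_a,\ell}-\hat f_\ell)^2\big]\le V$ for every $\ell\le L$, all analog values $s_{k,\ell}\in[-1,1]$ and all messages. Let $\mathcal C(\beta,V)\subseteq\mathbb R^{K_d}$ be the closure of the set of all $R$ for which $R,\beta,V$ are achievable. Let $\mathcal C_{\mathrm{MAC}}(\mathcal P_1,\dots,\mathcal P_{K_d};\mathcal A_1,\dots,\mathcal A_{K_d})$ be the capacity region of the same channel with only the $K_d$ digital transmitters: the closure of the set of tuples $R\in[0,\infty)^{K_d}$ for which there are codes of every block length $n\ge1$, of rates at least $R$, with codewords of amplitude at most $\mathcal A_k$ and average power at most $\mathcal P_k$, whose average decoding error probability tends to $0$. Write $C(x)=\frac12\log(1+x)$ and $x^+=\max(x,0)$. **Theorem 1.** Let $\beta\in(0,1)$, $\beta'=\min\{1/n:\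 n\in\mathbb N,\ n\ge 1,\ 1/n>\beta\}$ and $V=\beta'\sigma^2/\mathcal A_a^2$. Then $$\mathcal I\ \subseteq\ \mathcal C(\beta,V)\ \subseteq\ \mathcal O,$$ where $$\mathcal I=(1-\beta')\cdot\mathcal C_{\mathrm{MAC}}\Big(\tfrac{\mathcal P_1}{1-\beta},\dots,\tfrac{\mathcal P_{K_d}}{1-\beta};\ \tfrac{\sqrt2-1}{\sqrt2}\mathcal A_1,\dots,\tfrac{\sqrt2-1}{\sqrt2}\mathcal A_{K_d}\Big)$$ and $\mathcal O$ is the set of all $R\in\mathbb R^{K_d}$ such that for every $J\subseteq\{1,\dots,K_d\}$ $$\sum_{j\in J}R_j\ \le\ \min_{k\in\{0,\dots,K_a\}}\left[C\!\left(\frac{\sum_{j\in J}\mathcal P_j+k^2\mathcal A_a^2}{\sigma^2}\right)-\left(\frac\beta2\log\frac{2k^2}{\pi eV}\right)^{+}\right]$$ (for $k=0$ the subtracted term is $0$). -/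

import Mathlib

open MeasureTheory ProbabilityTheory Filter Topology

noncomputable section

/-! ### The additive white Gaussian noise multiple access channel -/

/-- Law of `n` i.i.d. `N(0, σ²)` noise samples. -/
def noiseLaw (σ : ℝ) (n : ℕ) : Measure (Fin n → ℝ) :=
  Measure.pi fun _ => gaussianReal 0 (σ ^ 2).toNNReal

/-- Law of the channel output `Yⁿ`, `Y_i = ∑ₖ X_{k,i} + N_i`, of `n` uses of the Gaussian multiple
access channel when transmitter `k` sends the sequence `x k`. -/
def macOutputLaw (σ : ℝ) {ι : Type} [Fintype ι] {n : ℕ} (x : ι → Fin n → ℝ) :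
    Measure (Fin n → ℝ) :=
  (noiseLaw σ n).map fun z => ∑ k, x k + z

/-- Peak amplitude constraint: maximum norm at most `a` (the norm of `Fin n → ℝ` is the maximum
norm). -/
def AmplitudeBounded {n : ℕ} (a : ℝ) (x : Fin n → ℝ) : Prop :=
  ‖x‖ ≤ a

/-- Average power constraint: `(1/n) ‖x‖₂² ≤ p`. -/
def PowerBounded {n : ℕ} (p : ℝ) (x : Fin n → ℝ) : Prop :=
  (1 / (n : ℝ)) * ∑ i, x i ^ 2 ≤ p

/-! ### Digital communication only -/

/-- A code of block length `n` for the multiple access channel with `K` transmitters; the message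
set of transmitter `k` is `Fin (M k)`. (The decoder forces every `M k` to be positive.) -/
structure MacCode (K n : ℕ) where
  M : Fin K → ℕ
  enc : (k : Fin K) → Fin (M k) → Fin n → ℝ
  dec : (Fin n → ℝ) → (k : Fin K) → Fin (M k)
  measurable_dec : Measurable dec

/-- Average decoding error probability of a code (uniform messages). -/
def MacCode.error {K n : ℕ} (c : MacCode K n) (σ : ℝ) : ℝ :=
  (∏ k, (c.M k : ℝ))⁻¹ *
    ∑ m : (k : Fin K) → Fin (c.M k),
      (macOutputLaw σ fun k => c.enc k (m k)).real {y | c.dec y ≠ m}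

/-- Achievability of the rate tuple `R` over the Gaussian multiple access channel under average
power constraints `P` and amplitude constraints `A`. -/
def MacAchievable {K : ℕ} (σ : ℝ) (P A R : Fin K → ℝ) : Prop :=
  (∀ k, 0 ≤ R k) ∧
  ∃ c : (n : ℕ) → MacCode K n,
    (∀ n, 0 < n → ∀ k, R k ≤ Real.log ((c n).M k) / n) ∧
    (∀ n, 0 < n → ∀ k m,
      PowerBounded (P k) ((c n).enc k m) ∧ AmplitudeBounded (A k) ((c n).enc k m)) ∧
    Tendsto (fun n => (c n).error σ) atTop (𝓝 0)

/-- Capacity region of the Gaussian multiple access channel under average power and amplitude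
constraints. -/
def macCapacity {K : ℕ} (σ : ℝ) (P A : Fin K → ℝ) : Set (Fin K → ℝ) :=
  closure {R | MacAchievable σ P A R}

/-! ### Simultaneous digital communication and over-the-air computation -/

/-- A scheme of block length `n` with `Ka` analog and `Kd` digital transmitters. Analog
transmitter `k` holds `L` values in `[-1, 1]`, digital transmitter `k` holds a message in
`Fin (M k)`; from the channel output the receiver produces estimates of the messages and of the
`L` function values. -/
structure SoccScheme (Ka Kd n : ℕ) where
  L : ℕ
  M : Fin Kd → ℕ
  analogEnc : Fin Ka → (Fin L → Set.Icc (-1 : ℝ) 1) → Fin n → ℝ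
  measurable_analogEnc : ∀ k, Measurable (analogEnc k)
  digitalEnc : (k : Fin Kd) → Fin (M k) → Fin n → ℝ
  digitalDec : (Fin n → ℝ) → (k : Fin Kd) → Fin (M k)
  measurable_digitalDec : Measurable digitalDec
  analogDec : (Fin n → ℝ) → Fin L → ℝ
  measurable_analogDec : Measurable analogDec

namespace SoccScheme

/-- Law of the channel output given the analog values `s` and the digital messages `m`. -/
def outputLaw {Ka Kd n : ℕ} (S : SoccScheme Ka Kd n) (σ : ℝ)
    (s : Fin Ka → Fin S.L → Set.Icc (-1 : ℝ) 1) (m : (k : Fin Kd) → Fin (S.M k)) :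
    Measure (Fin n → ℝ) :=
  macOutputLaw σ (ι := Fin Ka ⊕ Fin Kd) <|
    Sum.elim (fun k => S.analogEnc k (s k)) (fun k => S.digitalEnc k (m k))

/-- Probability, under uniform messages, that some message is decoded wrongly, for given analog
values `s`. -/
def digitalError {Ka Kd n : ℕ} (S : SoccScheme Ka Kd n) (σ : ℝ)
    (s : Fin Ka → Fin S.L → Set.Icc (-1 : ℝ) 1) : ℝ :=
  (∏ k, (S.M k : ℝ))⁻¹ *
    ∑ m : (k : Fin Kd) → Fin (S.M k), (S.outputLaw σ s m).real {y | S.digitalDec y ≠ m}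

/-- Every estimate approximates the sum of the corresponding analog values with mean squared error
at most `V`, for all analog values and all digital messages. -/
def ApproximatesSums {Ka Kd n : ℕ} (S : SoccScheme Ka Kd n) (σ V : ℝ) : Prop :=
  ∀ (ℓ : Fin S.L) (s : Fin Ka → Fin S.L → Set.Icc (-1 : ℝ) 1) (m : (k : Fin Kd) → Fin (S.M k)),
    ∫⁻ y, ENNReal.ofReal ((∑ k, (s k ℓ : ℝ) - S.analogDec y ℓ) ^ 2) ∂(S.outputLaw σ s m)
      ≤ ENNReal.ofReal V

/-- The amplitude constraint of the analog transmitters and the amplitude and average power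
constraints of the digital transmitters. -/
def MeetsConstraints {Ka Kd n : ℕ} (S : SoccScheme Ka Kd n) (Aa : ℝ) (P A : Fin Kd → ℝ) : Prop :=
  (∀ k s, AmplitudeBounded Aa (S.analogEnc k s)) ∧
  ∀ k m, AmplitudeBounded (A k) (S.digitalEnc k m) ∧ PowerBounded (P k) (S.digitalEnc k m)

end SoccScheme

/-- Achievability of digital rates `R` together with analog rate `β` and analog error `V`. The
digital decoding error tends to `0` uniformly in the analog values. -/
def SoccAchievable (Ka : ℕ) {Kd : ℕ} (σ Aa : ℝ) (P A : Fin Kd → ℝ) (β V : ℝ)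
    (R : Fin Kd → ℝ) : Prop :=
  (∀ k, 0 ≤ R k) ∧
  ∃ S : (n : ℕ) → SoccScheme Ka Kd n,
    (∀ n, 0 < n → ∀ k, R k ≤ Real.log ((S n).M k) / n) ∧
    (∀ n, 0 < n → β ≤ ((S n).L : ℝ) / n) ∧
    (∀ n, 0 < n → (S n).MeetsConstraints Aa P A) ∧
    (∀ ε > 0, ∀ᶠ n in atTop, ∀ s, (S n).digitalError σ s ≤ ε) ∧
    (∀ᶠ n in atTop, (S n).ApproximatesSums σ V)

/-- The region of digital rates for analog rate `β` and analog error `V`. -/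
def soccCapacity (Ka : ℕ) {Kd : ℕ} (σ Aa : ℝ) (P A : Fin Kd → ℝ) (β V : ℝ) :
    Set (Fin Kd → ℝ) :=
  closure {R | SoccAchievable Ka σ Aa P A β V R}

/-! ### The inner and outer regions -/

/-- The inner region: the constrained capacity region of the multiple access channel with powers
`P / (1 - β)` and amplitudes `A / (√2 / (√2 - 1))`, scaled by `1 - β'`. For `β' < 1` this is the
set of all `R` such that `R / (1 - β')` lies in that capacity region; for `β' = 1` it is `{0}`. -/
def soccInner {Kd : ℕ} (σ : ℝ) (P A : Fin Kd → ℝ) (β β' : ℝ) : Set (Fin Kd → ℝ) :=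
  {R | ∃ R' ∈ macCapacity σ (fun k => P k / (1 - β)) (fun k => A k / (√2 / (√2 - 1))),
    ∀ k, R k = (1 - β') * R' k}

/-- Gaussian capacity function. -/
def gaussianCapacity (x : ℝ) : ℝ :=
  1 / 2 * Real.log (1 + x)

/-- The outer region. For `k = 0` the subtracted positive part is `0`, both with the convention
`log 0 = -∞` and with `Real.log 0 = 0`. -/
def soccOuter (Ka : ℕ) {Kd : ℕ} (σ Aa : ℝ) (P : Fin Kd → ℝ) (β V : ℝ) : Set (Fin Kd → ℝ) :=
  {R | ∀ J : Finset (Fin Kd),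
    ∑ j ∈ J, R j ≤
      (Finset.range (Ka + 1)).inf' Finset.nonempty_range_add_one fun k =>
        gaussianCapacity ((∑ j ∈ J, P j + (k : ℝ) ^ 2 * Aa ^ 2) / σ ^ 2) -
          max (β / 2 * Real.log (2 * (k : ℝ) ^ 2 / (Real.pi * Real.exp 1 * V))) 0}

end

/-! Outer bound. Fix `J` and `k`. Make the messages in `J` uniform and freeze the others; let the
first `k` analog transmitters all hold the same i.i.d. uniform values `θ`, the rest zeros. After
centring, the noiseless channel input has average second moment at most `∑ P j + k² Aa²`, so the
output carries at most `n` Gaussian capacities of information about messages and `θ` together.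
Entropies are avoided: `integral_score_le` is a Gibbs-type inequality, which bounds the mean of any
score whose exponential is controlled for each fixed output. The score used in
`SoccScheme.sum_log_add_le` is `log ∏ M j` on correct decoding plus, for each `ℓ`, the log-ratio of
a Gaussian density of variance `V` around the estimate to the uniform density of `k θ ℓ`. The first
part has mean at least `(1 - ε) log ∏ M j`; each analog term has mean at least `1/2 log (2k² / (π e
V))`, by the mean squared error bound. Dividing by `n`, then `n → ∞` and `ε → 0`, gives the outer
region.

Inner bound. Write `β' = 1/N`. Each analog value is repeated over its own block of `N` channel uses
at full amplitude, and averaging a block gives squared error exactly `σ² / (N Aa²) = V`. With `n /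
N` blocks (rounded down), the vectors that sum to zero on every block form a space of dimension `n -
n / N`, in which the digital codewords are sent through an isometry. Analog and digital signals do
not disturb each other, and projected white noise is white, so the code sees its own channel
(`superposition_digitalError`). An isometry keeps energy but can raise the peak amplitude; the
Haar-like basis of `hasBalancedFamily_fin`, built by recursive halving, raises it by at most `2 + √2
= √2 / (√2 - 1)`, independently of `N` and `n`. -/

open scoped NNReal ENNReal

/-! ### Gaussian product measures and changes of density -/

theorem lintegral_pi_prod_eq {ι : Type*} [Fintype ι] {E : ι → Type*}
    {mE : ∀ i, MeasurableSpace (E i)} (μ : (i : ι) → Measure (E i))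
    [∀ i, IsProbabilityMeasure (μ i)] (f : (i : ι) → E i → ℝ≥0∞) (hf : ∀ i, Measurable (f i)) :
    ∫⁻ x, ∏ i, f i (x i) ∂(Measure.pi μ) = ∏ i, ∫⁻ x, f i x ∂(μ i) := by
  rw [lintegral_prod_eq_prod_lintegral_of_indepFun Finset.univ (fun i (x : (i : ι) → E i) => f i (x i))
    (iIndepFun_pi fun i => (hf i).aemeasurable) fun i => (hf i).comp (measurable_pi_apply i)]
  exact Finset.prod_congr rfl fun i _ =>
    (measurePreserving_eval μ i).lintegral_comp (hf i)

/-- The logarithm of the density of `N(b, T)` with respect to `N(a, v)`. -/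
noncomputable def gaussianLLR (a : ℝ) (v : ℝ≥0) (b : ℝ) (T : ℝ≥0) (y : ℝ) : ℝ :=
  1 / 2 * Real.log (v / T) - (y - b) ^ 2 / (2 * T) + (y - a) ^ 2 / (2 * v)

@[fun_prop]
theorem measurable_gaussianLLR (a : ℝ) (v : ℝ≥0) (b : ℝ) (T : ℝ≥0) :
    Measurable (gaussianLLR a v b T) := by
  unfold gaussianLLR; fun_prop

theorem gaussianPDFReal_mul_exp_gaussianLLR (a : ℝ) {v : ℝ≥0} (hv : v ≠ 0) (b : ℝ) {T : ℝ≥0}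
    (hT : T ≠ 0) (y : ℝ) :
    gaussianPDFReal a v y * Real.exp (gaussianLLR a v b T y) = gaussianPDFReal b T y := by
  have hv' : (0 : ℝ) < v := by positivity
  have hT' : (0 : ℝ) < T := by positivity
  have hlog : Real.exp (1 / 2 * Real.log (v / T)) = √v / √T := by
    rw [← Real.sqrt_div hv'.le, mul_comm, Real.exp_mul, Real.exp_log (by positivity),
      Real.sqrt_eq_rpow]
  have hpi : (0 : ℝ) ≤ 2 * Real.pi := by positivity
  simp only [gaussianPDFReal, gaussianLLR]
  rw [Real.exp_add _ ((y - a) ^ 2 / (2 * (v : ℝ))), sub_eq_add_neg (1 / 2 * _),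
    Real.exp_add _ (-((y - b) ^ 2 / (2 * (T : ℝ)))), hlog, Real.sqrt_mul hpi, Real.sqrt_mul hpi,
    neg_div, neg_div]
  have h1 : Real.exp (-((y - a) ^ 2 / (2 * (v : ℝ)))) * Real.exp ((y - a) ^ 2 / (2 * (v : ℝ))) = 1 := by
    rw [← Real.exp_add]; simp
  have : √(v : ℝ) ≠ 0 := by positivity
  have : √(T : ℝ) ≠ 0 := by positivity
  have : √(2 * Real.pi) ≠ 0 := by positivity
  calc _ = (√(2 * Real.pi) * √(v : ℝ))⁻¹ * (√v / √T) * Real.exp (-((y - b) ^ 2 / (2 * (T : ℝ)))) *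
        (Real.exp (-((y - a) ^ 2 / (2 * (v : ℝ)))) * Real.exp ((y - a) ^ 2 / (2 * (v : ℝ)))) := by
        ring
    _ = _ := by rw [h1]; field_simp

theorem gaussianReal_withDensity_gaussianLLR (a : ℝ) {v : ℝ≥0} (hv : v ≠ 0) (b : ℝ) {T : ℝ≥0}
    (hT : T ≠ 0) :
    (gaussianReal a v).withDensity (fun y => ENNReal.ofReal (Real.exp (gaussianLLR a v b T y))) =
      gaussianReal b T := by
  rw [gaussianReal_of_var_ne_zero a hv, gaussianReal_of_var_ne_zero b hT,
    ← withDensity_mul _ (measurable_gaussianPDF a v) (by fun_prop)]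
  congr 1
  ext y
  rw [Pi.mul_apply, gaussianPDF, gaussianPDF, ← ENNReal.ofReal_mul (gaussianPDFReal_nonneg _ _ _),
    gaussianPDFReal_mul_exp_gaussianLLR a hv b hT]

theorem pi_withDensity_prod {ι : Type*} [Fintype ι] {E : ι → Type*}
    {mE : ∀ i, MeasurableSpace (E i)} (μ : (i : ι) → Measure (E i))
    [∀ i, IsProbabilityMeasure (μ i)] (f : (i : ι) → E i → ℝ≥0∞) (hf : ∀ i, Measurable (f i))
    [∀ i, SigmaFinite ((μ i).withDensity (f i))] :
    (Measure.pi μ).withDensity (fun x => ∏ i, f i (x i)) =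
      Measure.pi fun i => (μ i).withDensity (f i) := by
  symm
  refine Measure.pi_eq fun s hs => ?_
  rw [withDensity_apply _ (MeasurableSet.univ_pi hs), ← lintegral_indicator (MeasurableSet.univ_pi hs)]
  have : (Set.univ.pi s).indicator (fun x => ∏ i, f i (x i)) =
      fun x => ∏ i, (s i).indicator (f i) (x i) := by
    classical
    ext x
    by_cases hx : x ∈ Set.univ.pi s
    · rw [Set.indicator_of_mem hx]
      exact Finset.prod_congr rfl fun i _ => (Set.indicator_of_mem (hx i trivial) _).symm
    · rw [Set.indicator_of_notMem hx]
      simp only [Set.mem_pi, Set.mem_univ, true_implies, not_forall] at hx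
      obtain ⟨i, hi⟩ := hx
      exact (Finset.prod_eq_zero (Finset.mem_univ i) (Set.indicator_of_notMem hi _)).symm
  rw [this, lintegral_pi_prod_eq μ _ fun i => (hf i).indicator (hs i)]
  refine Finset.prod_congr rfl fun i _ => ?_
  rw [lintegral_indicator (hs i), withDensity_apply _ (hs i)]

instance isProbabilityMeasure_noiseLaw (σ : ℝ) (n : ℕ) : IsProbabilityMeasure (noiseLaw σ n) := by
  unfold noiseLaw; infer_instance

theorem noiseLaw_map_const_add (σ : ℝ) {n : ℕ} (x : Fin n → ℝ) :
    (noiseLaw σ n).map (fun z => x + z) =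
      Measure.pi fun i => gaussianReal (x i) (σ ^ 2).toNNReal := by
  have h : ∀ i, (gaussianReal 0 (σ ^ 2).toNNReal).map (fun t => x i + t) =
      gaussianReal (x i) (σ ^ 2).toNNReal := fun i => by
    rw [gaussianReal_map_const_add, zero_add]
  have (i : Fin n) : SigmaFinite ((gaussianReal 0 (σ ^ 2).toNNReal).map (fun t => x i + t)) := by
    rw [h]; infer_instance
  have := Measure.pi_map_pi (μ := fun _ : Fin n => gaussianReal 0 (σ ^ 2).toNNReal)
    (f := fun i t => x i + t) (fun i => by fun_prop)
  simp only [h] at this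
  exact this

/-- Changing the noise law into the reference law `∏ᵢ N(bᵢ, T)` for the channel output. -/
theorem lintegral_noiseLaw_mul_exp_llr {σ : ℝ} (hσ : 0 < σ) {n : ℕ} (x b : Fin n → ℝ) {T : ℝ≥0}
    (hT : T ≠ 0) (F : (Fin n → ℝ) → ℝ≥0∞) (hF : Measurable F) :
    ∫⁻ z, F (x + z) * ENNReal.ofReal
        (Real.exp (∑ i, gaussianLLR (x i) (σ ^ 2).toNNReal (b i) T (x i + z i))) ∂(noiseLaw σ n) =
      ∫⁻ y, F y ∂(Measure.pi fun i => gaussianReal (b i) T) := by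
  have hv : (σ ^ 2).toNNReal ≠ 0 := by
    rw [ne_eq, Real.toNNReal_eq_zero]; push Not; positivity
  have hd := fun i : Fin n => gaussianReal_withDensity_gaussianLLR (x i) hv (b i) hT
  have (i : Fin n) : SigmaFinite ((gaussianReal (x i) (σ ^ 2).toNNReal).withDensity
      (fun y => ENNReal.ofReal (Real.exp (gaussianLLR (x i) (σ ^ 2).toNNReal (b i) T y)))) := by
    rw [hd]; infer_instance
  have key := pi_withDensity_prod (fun i : Fin n => gaussianReal (x i) (σ ^ 2).toNNReal)
    (fun i y => ENNReal.ofReal (Real.exp (gaussianLLR (x i) (σ ^ 2).toNNReal (b i) T y)))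
    (fun i => by fun_prop)
  simp only [hd] at key
  rw [← key, ← noiseLaw_map_const_add, lintegral_withDensity_eq_lintegral_mul _ (by fun_prop) hF,
    lintegral_map (by fun_prop) (by fun_prop)]
  refine lintegral_congr fun z => ?_
  rw [Real.exp_sum, ENNReal.ofReal_prod_of_nonneg fun i _ => (Real.exp_pos _).le]
  simp [mul_comm]

theorem integrable_noiseLaw_eval (σ : ℝ) {n : ℕ} (i : Fin n) :
    Integrable (fun z => z i) (noiseLaw σ n) :=
  integrable_comp_eval (μ := fun _ : Fin n => gaussianReal 0 (σ ^ 2).toNNReal) (i := i) (f := id)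
    ((memLp_id_gaussianReal 1).integrable (by simp))

theorem memLp_noiseLaw_eval (σ : ℝ) {n : ℕ} (i : Fin n) :
    MemLp (fun z => z i) 2 (noiseLaw σ n) :=
  (memLp_id_gaussianReal 2).comp_measurePreserving
    (measurePreserving_eval (fun _ : Fin n => gaussianReal 0 (σ ^ 2).toNNReal) i)

theorem integral_noiseLaw_eval (σ : ℝ) {n : ℕ} (i : Fin n) :
    ∫ z, z i ∂(noiseLaw σ n) = 0 := by
  have := integral_comp_eval (μ := fun _ : Fin n => gaussianReal 0 (σ ^ 2).toNNReal) (i := i)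
    (f := fun t : ℝ => t) (by fun_prop)
  rw [noiseLaw, this, integral_id_gaussianReal]

theorem integral_noiseLaw_eval_sq (σ : ℝ) {n : ℕ} (i : Fin n) :
    ∫ z, z i ^ 2 ∂(noiseLaw σ n) = σ ^ 2 := by
  have := integral_comp_eval (μ := fun _ : Fin n => gaussianReal 0 (σ ^ 2).toNNReal) (i := i)
    (f := fun t : ℝ => t ^ 2) (by fun_prop)
  rw [noiseLaw, this]
  have h := variance_fun_id_gaussianReal (μ := 0) (v := (σ ^ 2).toNNReal)
  rw [variance_eq_integral (by fun_prop), integral_id_gaussianReal] at h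
  simpa [sq_nonneg] using h

/-- Separates input and noise, so that under independent `a` and `z` the mean involves only second
moments. -/
theorem gaussianLLR_add (a : ℝ) (v : ℝ≥0) (b : ℝ) (T : ℝ≥0) (z : ℝ) :
    gaussianLLR a v b T (a + z) = 1 / 2 * Real.log (v / T) - (2 * T : ℝ)⁻¹ * (a - b) ^ 2
      - (T : ℝ)⁻¹ * ((a - b) * z) + ((2 * v : ℝ)⁻¹ - (2 * T : ℝ)⁻¹) * z ^ 2 := by
  unfold gaussianLLR
  simp only [div_eq_mul_inv, mul_inv]
  ring

theorem integrable_of_bounded {Ω : Type*} [MeasurableSpace Ω] (W : Measure Ω) [IsFiniteMeasure W]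
    {f : Ω → ℝ} (hf : Measurable f) {B : ℝ} (hB : ∀ w, |f w| ≤ B) : Integrable f W :=
  Integrable.of_bound hf.aestronglyMeasurable B (ae_of_all _ hB)

/-! ### Variational bound for the Gaussian channel -/

section OneShot

variable {Ω : Type*} [MeasurableSpace Ω] (W : Measure Ω) [IsProbabilityMeasure W] (σ : ℝ)

/-- The noise is centred and independent of the input, so the cross term vanishes. The law of the
input enters only through its second moment about `b`. -/
theorem integrable_gaussianLLR_prod {n : ℕ} (i : Fin n) {a : Ω → ℝ} (ha : Measurable a)
    {B : ℝ} (hB : ∀ w, |a w| ≤ B) (b : ℝ) (v T : ℝ≥0) :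
    Integrable (fun p : Ω × (Fin n → ℝ) => gaussianLLR (a p.1) v b T (a p.1 + p.2 i))
      (W.prod (noiseLaw σ n)) ∧
    ∫ p : Ω × (Fin n → ℝ), gaussianLLR (a p.1) v b T (a p.1 + p.2 i) ∂(W.prod (noiseLaw σ n)) =
      1 / 2 * Real.log (v / T) - (2 * T : ℝ)⁻¹ * ∫ w, (a w - b) ^ 2 ∂W
        + ((2 * v : ℝ)⁻¹ - (2 * T : ℝ)⁻¹) * σ ^ 2 := by
  have hab : ∀ w, |a w - b| ≤ B + |b| := fun w => (abs_sub _ _).trans (by gcongr; exact hB w)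
  have i1 : Integrable (fun w => a w - b) W := integrable_of_bounded W (by fun_prop) hab
  have i2 : Integrable (fun w => (a w - b) ^ 2) W :=
    integrable_of_bounded W (B := (B + |b|) ^ 2) (by fun_prop) fun w => by
      rw [abs_pow]; gcongr; exact hab w
  have j1 : Integrable (fun p : Ω × (Fin n → ℝ) => (a p.1 - b) ^ 2) (W.prod (noiseLaw σ n)) :=
    i2.comp_fst _
  have j2 : Integrable (fun p : Ω × (Fin n → ℝ) => (a p.1 - b) * p.2 i) (W.prod (noiseLaw σ n)) :=
    i1.mul_prod (integrable_noiseLaw_eval σ i)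
  have j3 : Integrable (fun p : Ω × (Fin n → ℝ) => p.2 i ^ 2) (W.prod (noiseLaw σ n)) :=
    (memLp_noiseLaw_eval σ i).integrable_sq.comp_snd _
  have e1 : ∫ p : Ω × (Fin n → ℝ), (a p.1 - b) ^ 2 ∂(W.prod (noiseLaw σ n)) =
      ∫ w, (a w - b) ^ 2 ∂W := by
    rw [integral_fun_fst (fun w => (a w - b) ^ 2)]; simp
  have e2 : ∫ p : Ω × (Fin n → ℝ), (a p.1 - b) * p.2 i ∂(W.prod (noiseLaw σ n)) = 0 := by
    rw [integral_prod_mul (fun w => a w - b) (fun z : Fin n → ℝ => z i), integral_noiseLaw_eval,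
      mul_zero]
  have e3 : ∫ p : Ω × (Fin n → ℝ), p.2 i ^ 2 ∂(W.prod (noiseLaw σ n)) = σ ^ 2 := by
    rw [integral_fun_snd (fun z : Fin n → ℝ => z i ^ 2), integral_noiseLaw_eval_sq]; simp
  simp only [gaussianLLR_add]
  have k0 : Integrable (fun _ : Ω × (Fin n → ℝ) => 1 / 2 * Real.log (v / T))
    (W.prod (noiseLaw σ n)) := integrable_const _
  have k1 := j1.const_mul (2 * T : ℝ)⁻¹
  have k2 := j2.const_mul (T : ℝ)⁻¹
  have k3 := j3.const_mul ((2 * v : ℝ)⁻¹ - (2 * T : ℝ)⁻¹)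
  have k01 : Integrable (fun p : Ω × (Fin n → ℝ) => 1 / 2 * Real.log (v / T)
    - (2 * T : ℝ)⁻¹ * (a p.1 - b) ^ 2) (W.prod (noiseLaw σ n)) := k0.sub k1
  have k02 : Integrable (fun p : Ω × (Fin n → ℝ) => 1 / 2 * Real.log (v / T)
    - (2 * T : ℝ)⁻¹ * (a p.1 - b) ^ 2 - (T : ℝ)⁻¹ * ((a p.1 - b) * p.2 i))
    (W.prod (noiseLaw σ n)) := k01.sub k2
  refine ⟨k02.add k3, ?_⟩
  rw [integral_add k02 k3, integral_sub k01 k2, integral_sub k0 k1,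
    integral_const_mul (2 * T : ℝ)⁻¹, integral_const_mul (T : ℝ)⁻¹,
    integral_const_mul ((2 * v : ℝ)⁻¹ - (2 * T : ℝ)⁻¹), e1, e2, e3]
  simp

/-- Variational bound on the information transmitted over the Gaussian channel: if the
exponential of the score `g` has mean at most `C` for every fixed channel output, then the mean of
the score under the joint law of input and output is at most `log C` plus `n` times the
Gaussian capacity. -/
theorem integral_score_le {σ : ℝ} (hσ : 0 < σ) {n : ℕ} (x : Ω → Fin n → ℝ) (hx : Measurable x)
    {B : ℝ} (hB : ∀ w i, |x w i| ≤ B) (b : Fin n → ℝ) {P : ℝ} (hP : 0 ≤ P)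
    (hvar : ∑ i, ∫ w, (x w i - b i) ^ 2 ∂W ≤ n * P)
    (g : Ω → (Fin n → ℝ) → ℝ) (hg : Measurable (Function.uncurry g)) {C : ℝ} (hC0 : 0 < C)
    (hC : ∀ y, ∫⁻ w, ENNReal.ofReal (Real.exp (g w y)) ∂W ≤ ENNReal.ofReal C)
    (hint : Integrable (fun p : Ω × (Fin n → ℝ) => g p.1 (x p.1 + p.2))
      (W.prod (noiseLaw σ n))) :
    ∫ p : Ω × (Fin n → ℝ), g p.1 (x p.1 + p.2) ∂(W.prod (noiseLaw σ n)) ≤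
      Real.log C + n * gaussianCapacity (P / σ ^ 2) := by
  set v : ℝ≥0 := (σ ^ 2).toNNReal with hv
  -- The reference output variance is signal plus noise; with it the two quadratic terms in the mean
  -- of `ρ` cancel when the second moment constraint is tight.
  set T : ℝ≥0 := (σ ^ 2 + P).toNNReal with hT
  have hvr : (v : ℝ) = σ ^ 2 := Real.coe_toNNReal _ (by positivity)
  have hTr : (T : ℝ) = σ ^ 2 + P := Real.coe_toNNReal _ (by positivity)
  have hT0 : T ≠ 0 := by
    rw [hT, ne_eq, Real.toNNReal_eq_zero]; push Not; positivity
  have hxi : ∀ i, Measurable fun w => x w i := fun i => by fun_prop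
  have hL := fun i => integrable_gaussianLLR_prod W σ i (hxi i) (fun w => hB w i) (b i) v T
  set ρ : Ω × (Fin n → ℝ) → ℝ := fun p => ∑ i, gaussianLLR (x p.1 i) v (b i) T (x p.1 i + p.2 i)
    with hρ
  have hρi : Integrable ρ (W.prod (noiseLaw σ n)) := integrable_finsetSum _ fun i _ => (hL i).1
  have hρm : Measurable ρ := by
    simp only [hρ, gaussianLLR_add]; fun_prop
  have hρI : - (n * gaussianCapacity (P / σ ^ 2)) ≤ ∫ p, ρ p ∂(W.prod (noiseLaw σ n)) := by
    rw [hρ, integral_finsetSum _ fun i _ => (hL i).1, Finset.sum_congr rfl fun i _ => (hL i).2,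
      Finset.sum_add_distrib, Finset.sum_sub_distrib,
      ← Finset.mul_sum (f := fun i => ∫ w, (x w i - b i) ^ 2 ∂W)]
    simp only [Finset.sum_const, Finset.card_univ, Fintype.card_fin, nsmul_eq_mul, hvr, hTr]
    have h1 : Real.log (σ ^ 2 / (σ ^ 2 + P)) = - Real.log (1 + P / σ ^ 2) := by
      rw [← Real.log_inv]; congr 1; field_simp
    have h2 : (2 * (σ ^ 2 + P))⁻¹ * ∑ i, ∫ w, (x w i - b i) ^ 2 ∂W ≤
        (2 * (σ ^ 2 + P))⁻¹ * (n * P) := by gcongr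
    have h3 : (n : ℝ) * (((2 * σ ^ 2)⁻¹ - (2 * (σ ^ 2 + P))⁻¹) * σ ^ 2) =
        (2 * (σ ^ 2 + P))⁻¹ * (n * P) := by
      field_simp; ring
    rw [h1, h3, gaussianCapacity]
    linarith
  -- Weighting by `exp ρ` replaces the true output by a reference output independent of the input,
  -- so the mean of `exp h` can be computed with the output held fixed.
  set h : Ω × (Fin n → ℝ) → ℝ := fun p => g p.1 (x p.1 + p.2) + ρ p - Real.log C with hh
  have hhm : Measurable h := by
    have : Measurable fun p : Ω × (Fin n → ℝ) => g p.1 (x p.1 + p.2) :=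
      hg.comp (f := fun p : Ω × (Fin n → ℝ) => (p.1, x p.1 + p.2)) (by fun_prop)
    exact (this.add hρm).sub_const _
  have hhi : Integrable h (W.prod (noiseLaw σ n)) := (hint.add hρi).sub (integrable_const _)
  have hexp : ∫⁻ p, ENNReal.ofReal (Real.exp (h p)) ∂(W.prod (noiseLaw σ n)) ≤ 1 := by
    rw [lintegral_prod _ (by fun_prop)]
    have hgw : ∀ w, Measurable (g w) := fun w => hg.comp (measurable_prodMk_left (x := w))
    have : ∀ w, ∫⁻ z, ENNReal.ofReal (Real.exp (h (w, z))) ∂(noiseLaw σ n) =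
        (ENNReal.ofReal C)⁻¹ *
          ∫⁻ y, ENNReal.ofReal (Real.exp (g w y)) ∂(Measure.pi fun i => gaussianReal (b i) T) := by
      intro w
      rw [← lintegral_noiseLaw_mul_exp_llr hσ (x w) b hT0 _ (by fun_prop),
        ← lintegral_const_mul _ (by
          have := hgw w
          have := hρm.comp (measurable_prodMk_left (x := w))
          simp only [hρ, Function.comp_def] at this
          fun_prop)]
      refine lintegral_congr fun z => ?_
      rw [← ENNReal.ofReal_mul (Real.exp_pos _).le, ← ENNReal.ofReal_inv_of_pos hC0,
        ← ENNReal.ofReal_mul (by positivity), ← Real.exp_add, hh]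
      simp only
      rw [Real.exp_sub, Real.exp_log hC0, div_eq_inv_mul]
    simp only [this]
    have hm : Measurable (Function.uncurry fun w y => ENNReal.ofReal (Real.exp (g w y))) := by
      have := (Real.measurable_exp.comp hg).ennreal_ofReal
      exact this
    have hm' : Measurable fun w => ∫⁻ y, ENNReal.ofReal (Real.exp (g w y))
        ∂(Measure.pi fun i => gaussianReal (b i) T) := hm.lintegral_prod_right'
    rw [lintegral_const_mul _ hm', lintegral_lintegral_swap hm.aemeasurable]
    calc _ ≤ (ENNReal.ofReal C)⁻¹ *
          ∫⁻ _, ENNReal.ofReal C ∂(Measure.pi fun i => gaussianReal (b i) T) := by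
          gcongr with y; exact hC y
      _ = 1 := by
        rw [lintegral_const, measure_univ, mul_one]
        exact ENNReal.inv_mul_cancel (by simpa using hC0) ENNReal.ofReal_ne_top
  have hexpi : Integrable (fun p => Real.exp (h p)) (W.prod (noiseLaw σ n)) := by
    refine ⟨by fun_prop, ?_⟩
    rw [hasFiniteIntegral_iff_ofReal (ae_of_all _ fun p => (Real.exp_pos _).le)]
    exact hexp.trans_lt ENNReal.one_lt_top
  have hle : ∫ p, Real.exp (h p) ∂(W.prod (noiseLaw σ n)) ≤ 1 := by
    rw [integral_eq_lintegral_of_nonneg_ae (ae_of_all _ fun p => (Real.exp_pos _).le)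
      hexpi.aestronglyMeasurable]
    exact ENNReal.toReal_le_of_le_ofReal zero_le_one (by simpa using hexp)
  -- The tangent line inequality plays the role of Jensen: `1 + 𝔼 h ≤ 𝔼 exp h ≤ 1`.
  have hmono : ∫ p, (h p + 1) ∂(W.prod (noiseLaw σ n)) ≤
      ∫ p, Real.exp (h p) ∂(W.prod (noiseLaw σ n)) :=
    integral_mono (hhi.add (integrable_const _)) hexpi fun p => Real.add_one_le_exp _
  have e1 : ∫ p, (h p + 1) ∂(W.prod (noiseLaw σ n)) =
      ∫ p : Ω × (Fin n → ℝ), g p.1 (x p.1 + p.2) ∂(W.prod (noiseLaw σ n)) +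
        ∫ p, ρ p ∂(W.prod (noiseLaw σ n)) - Real.log C + 1 := by
    have hgρ : Integrable (fun p : Ω × (Fin n → ℝ) => g p.1 (x p.1 + p.2) + ρ p)
      (W.prod (noiseLaw σ n)) := hint.add hρi
    rw [integral_add hhi (integrable_const _), hh, integral_sub hgρ (integrable_const _),
      integral_add hint hρi]
    simp only [integral_const, probReal_univ, one_smul]
  linarith

end OneShot

/-! ### Message laws -/

/-- The uniform law on `Fin N` if `p` holds, and the point mass at `a` otherwise. -/
noncomputable def uniformOrDirac (p : Prop) [Decidable p] {N : ℕ} (a : Fin N) : Measure (Fin N) :=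
  if p then uniformOn Set.univ else Measure.dirac a

instance isProbabilityMeasure_uniformOrDirac (p : Prop) [Decidable p] {N : ℕ} (a : Fin N) :
    IsProbabilityMeasure (uniformOrDirac p a) := by
  have : Nonempty (Fin N) := ⟨a⟩
  unfold uniformOrDirac
  split_ifs <;> infer_instance

theorem uniformOrDirac_real_singleton (p : Prop) [Decidable p] {N : ℕ} (a b : Fin N) :
    (uniformOrDirac p a).real {b} = if p then (N : ℝ)⁻¹ else if a = b then 1 else 0 := by
  unfold uniformOrDirac
  split_ifs with h1 h2
  · rw [measureReal_def, uniformOn_univ]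
    simp
  · simp [h2, measureReal_def]
  · simp [h2, measureReal_def]

theorem sum_uniformOrDirac_real_singleton (p : Prop) [Decidable p] {N : ℕ} (b : Fin N) :
    ∑ a, (uniformOrDirac p a).real {b} = 1 := by
  have : (N : ℝ) ≠ 0 := by
    have := b.pos
    positivity
  simp only [uniformOrDirac_real_singleton]
  split_ifs
  · simp [this]
  · simp

section MessageLaw

variable {K : ℕ} {M : Fin K → ℕ} (J : Finset (Fin K))

/-- Independent messages; those with index in `J` are uniform, the others are fixed. -/
noncomputable def messageLaw (m₀ : (k : Fin K) → Fin (M k)) : Measure ((k : Fin K) → Fin (M k)) :=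
  Measure.pi fun k => uniformOrDirac (k ∈ J) (m₀ k)

instance isProbabilityMeasure_messageLaw (m₀ : (k : Fin K) → Fin (M k)) :
    IsProbabilityMeasure (messageLaw J m₀) := by
  unfold messageLaw; infer_instance

theorem messageLaw_real_singleton (m₀ m : (k : Fin K) → Fin (M k)) :
    (messageLaw J m₀).real {m} = ∏ k, (uniformOrDirac (k ∈ J) (m₀ k)).real {m k} := by
  rw [messageLaw, measureReal_def, Measure.pi_singleton, ENNReal.toReal_prod]
  rfl

/-- Since every `m` has total weight one, averaging the laws over a uniform `m₀` returns the uniform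
law on messages. This turns an average error bound into one for some frozen `m₀`. -/
theorem sum_messageLaw_real_singleton (m : (k : Fin K) → Fin (M k)) :
    ∑ m₀, (messageLaw J m₀).real {m} = 1 := by
  simp only [messageLaw_real_singleton]
  rw [← Fintype.prod_sum (fun k a => (uniformOrDirac (k ∈ J) a).real {m k})]
  simp [sum_uniformOrDirac_real_singleton]

/-- A blind guess must hit every uniform coordinate in `J`; each frozen coordinate contributes a
factor at most one. -/
theorem messageLaw_real_singleton_le (m₀ m : (k : Fin K) → Fin (M k)) :
    (messageLaw J m₀).real {m} ≤ (∏ j ∈ J, (M j : ℝ))⁻¹ := by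
  have : ∏ k, (if k ∈ J then (M k : ℝ)⁻¹ else 1) = ∏ j ∈ J, (M j : ℝ)⁻¹ := by
    rw [Finset.prod_ite_mem, Finset.univ_inter]
  rw [messageLaw_real_singleton, ← Finset.prod_inv_distrib, ← this]
  refine Finset.prod_le_prod (fun k _ => measureReal_nonneg) fun k _ => ?_
  rw [uniformOrDirac_real_singleton]
  split_ifs <;> simp

/-- Variances of independent terms add and frozen messages have none, so only the powers of
transmitters in `J` count. -/
theorem variance_sum_messageLaw_le (m₀ : (k : Fin K) → Fin (M k)) (F : (k : Fin K) → Fin (M k) → ℝ) :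
    Var[fun m => ∑ k, F k (m k); messageLaw J m₀] ≤
      ∑ j ∈ J, ∫ a, F j a ^ 2 ∂(uniformOrDirac (j ∈ J) (m₀ j)) := by
  have h := variance_sum_pi (μ := fun k => uniformOrDirac (k ∈ J) (m₀ k)) (X := F)
    fun k => MemLp.of_discrete
  have e : (∑ k, fun m : (k : Fin K) → Fin (M k) => F k (m k)) = fun m => ∑ k, F k (m k) := by
    ext m; simp
  rw [e] at h
  rw [messageLaw, h, ← Finset.sum_subset (Finset.subset_univ J)]
  · refine Finset.sum_le_sum fun j _ => ?_
    have := variance_le_expectation_sq (μ := uniformOrDirac (j ∈ J) (m₀ j)) (X := F j)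
      Measurable.of_discrete.aestronglyMeasurable
    simpa using this
  · intro k _ hk
    simp [uniformOrDirac, hk]

/-- Some choice of the messages outside `J` is at least as good as the average. -/
theorem exists_integral_messageLaw_le [∀ k, NeZero (M k)] (f : ((k : Fin K) → Fin (M k)) → ℝ)
    {ε : ℝ} (hf : (∏ k, (M k : ℝ))⁻¹ * ∑ m, f m ≤ ε) :
    ∃ m₀, ∫ m, f m ∂(messageLaw J m₀) ≤ ε := by
  by_contra! hcon
  have hcard : ((Fintype.card ((k : Fin K) → Fin (M k)) : ℕ) : ℝ) = ∏ k, (M k : ℝ) := by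
    simp [Fintype.card_pi]
  have hpos : 0 < ∏ k, (M k : ℝ) :=
    Finset.prod_pos fun k _ => by exact_mod_cast Nat.pos_of_ne_zero (NeZero.ne (M k))
  have h1 : ∑ m₀ : (k : Fin K) → Fin (M k), ∫ m, f m ∂(messageLaw J m₀) = ∑ m, f m := by
    simp only [integral_fintype Integrable.of_finite]
    rw [Finset.sum_comm]
    simp only [smul_eq_mul, ← Finset.sum_mul, sum_messageLaw_real_singleton, one_mul]
  have h2 : ∑ _m₀ : (k : Fin K) → Fin (M k), ε <
      ∑ m₀ : (k : Fin K) → Fin (M k), ∫ m, f m ∂(messageLaw J m₀) :=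
    Finset.sum_lt_sum_of_nonempty Finset.univ_nonempty fun m₀ _ => hcon m₀
  rw [h1, Finset.sum_const, Finset.card_univ, nsmul_eq_mul, hcard] at h2
  rw [inv_mul_le_iff₀ hpos] at hf
  linarith

/-- The exponential of the score of a message estimate. -/
theorem lintegral_exp_indicator_messageLaw_le (m₀ m' : (k : Fin K) → Fin (M k)) :
    ∫⁻ m, ENNReal.ofReal (Real.exp (if m' = m then Real.log (∏ j ∈ J, (M j : ℝ)) else 0))
      ∂(messageLaw J m₀) ≤ 2 := by
  have hpos : 0 < ∏ j ∈ J, (M j : ℝ) :=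
    Finset.prod_pos fun k _ => by exact_mod_cast (m₀ k).pos
  calc _ ≤ ∫⁻ m, 1 + Set.indicator {m'} (fun _ => ENNReal.ofReal (∏ j ∈ J, (M j : ℝ))) m
        ∂(messageLaw J m₀) := by
        refine lintegral_mono fun m => ?_
        by_cases h : m' = m
        · subst h; simp [Real.exp_log hpos]
        · simp [h, Ne.symm h]
    _ = 1 + ENNReal.ofReal (∏ j ∈ J, (M j : ℝ)) * messageLaw J m₀ {m'} := by
        rw [lintegral_add_left measurable_const, lintegral_indicator_const (measurableSet_singleton _)]
        simp
    _ ≤ 1 + ENNReal.ofReal (∏ j ∈ J, (M j : ℝ)) * ENNReal.ofReal (∏ j ∈ J, (M j : ℝ))⁻¹ := by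
        gcongr
        rw [← ofReal_measureReal]
        exact ENNReal.ofReal_le_ofReal (messageLaw_real_singleton_le J m₀ m')
    _ = 2 := by
        rw [← ENNReal.ofReal_mul hpos.le, mul_inv_cancel₀ hpos.ne']
        norm_num

end MessageLaw

/-! ### The uniform law on `[-1, 1]` -/

/-- The uniform law on `[-1, 1]`. -/
noncomputable def uniformIcc : Measure (Set.Icc (-1 : ℝ) 1) :=
  (2 : ℝ≥0∞)⁻¹ • Measure.comap Subtype.val volume

instance isProbabilityMeasure_uniformIcc : IsProbabilityMeasure uniformIcc := by
  constructor
  rw [uniformIcc, Measure.smul_apply, comap_subtype_coe_apply measurableSet_Icc, Set.image_univ,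
    Subtype.range_coe, Real.volume_Icc]
  norm_num
  exact ENNReal.inv_mul_cancel (by simp) (by simp)

/-- The exponential of the score of an estimate `f` of `k` times a uniform variable. -/
theorem lintegral_exp_score_uniformIcc_le {k V : ℝ} (hk : 0 < k) (hV : 0 < V) (f : ℝ) :
    ∫⁻ t : Set.Icc (-1 : ℝ) 1, ENNReal.ofReal (Real.exp
      (1 / 2 * Real.log (2 * k ^ 2 / (Real.pi * V)) - (k * t - f) ^ 2 / (2 * V))) ∂uniformIcc ≤ 1 := by
  set v : ℝ≥0 := (V / k ^ 2).toNNReal with hv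
  have hvr : (v : ℝ) = V / k ^ 2 := Real.coe_toNNReal _ (by positivity)
  have hv0 : v ≠ 0 := by
    rw [hv, ne_eq, Real.toNNReal_eq_zero]; push Not; positivity
  -- The factor `2` is the reciprocal of the uniform density `1/2`, so the integral is the mass on
  -- `[-1, 1]` of a Gaussian with variance `V / k²`, hence at most one.
  have hexp : ∀ t : ℝ, Real.exp
      (1 / 2 * Real.log (2 * k ^ 2 / (Real.pi * V)) - (k * t - f) ^ 2 / (2 * V)) =
      2 * gaussianPDFReal (f / k) v t := by
    intro t
    have e1 : Real.exp (1 / 2 * Real.log (2 * k ^ 2 / (Real.pi * V))) =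
        2 * (√(2 * Real.pi * (V / k ^ 2)))⁻¹ := by
      rw [mul_comm, Real.exp_mul, Real.exp_log (by positivity), ← Real.sqrt_eq_rpow,
        Real.sqrt_eq_iff_mul_self_eq (by positivity) (by positivity), mul_mul_mul_comm, ← mul_inv,
        Real.mul_self_sqrt (by positivity)]
      field_simp
    have e2 : -((k * t - f) ^ 2 / (2 * V)) = -(t - f / k) ^ 2 / (2 * (V / k ^ 2)) := by
      field_simp
    rw [sub_eq_add_neg, Real.exp_add, e1, gaussianPDFReal, hvr, e2, mul_assoc]
  simp only [hexp]
  rw [uniformIcc, lintegral_smul_measure]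
  have : ∫⁻ t : Set.Icc (-1 : ℝ) 1, ENNReal.ofReal (2 * gaussianPDFReal (f / k) v t)
      ∂(Measure.comap Subtype.val volume) =
      ∫⁻ t in Set.Icc (-1 : ℝ) 1, ENNReal.ofReal (2 * gaussianPDFReal (f / k) v t) :=
    lintegral_subtype_comap (μ := volume) measurableSet_Icc
      fun t : ℝ => ENNReal.ofReal (2 * gaussianPDFReal (f / k) v t)
  rw [this]
  calc _ ≤ (2 : ℝ≥0∞)⁻¹ * ∫⁻ t, ENNReal.ofReal (2 * gaussianPDFReal (f / k) v t) := by
        rw [smul_eq_mul]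
        gcongr
        exact Measure.restrict_le_self
    _ = (2 : ℝ≥0∞)⁻¹ * (2 * 1) := by
        simp only [ENNReal.ofReal_mul zero_le_two]
        rw [lintegral_const_mul _ (by fun_prop), lintegral_gaussianPDFReal_eq_one _ hv0]
        simp
    _ = 1 := by
        rw [mul_one]; exact ENNReal.inv_mul_cancel (by simp) (by simp)

/-! ### The converse for a single block -/

/-- The first `k` analog transmitters hold the values `θ`, the others hold zeros. -/
noncomputable def repeatFirst (Ka k : ℕ) {L : ℕ} (θ : Fin L → Set.Icc (-1 : ℝ) 1) :
    Fin Ka → Fin L → Set.Icc (-1 : ℝ) 1 :=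
  fun i => if (i : ℕ) < k then θ else fun _ => ⟨0, by norm_num⟩

theorem measurable_repeatFirst (Ka k L : ℕ) : Measurable (repeatFirst Ka k (L := L)) := by
  refine measurable_pi_lambda _ fun i => ?_
  unfold repeatFirst
  split_ifs
  · exact measurable_id
  · exact measurable_const

theorem sum_repeatFirst {Ka k : ℕ} (hk : k ≤ Ka) {L : ℕ} (θ : Fin L → Set.Icc (-1 : ℝ) 1)
    (ℓ : Fin L) : ∑ i, (repeatFirst Ka k θ i ℓ : ℝ) = k * θ ℓ := by
  have : ∀ i : Fin Ka, (repeatFirst Ka k θ i ℓ : ℝ) = if (i : ℕ) < k then (θ ℓ : ℝ) else 0 := by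
    intro i; unfold repeatFirst; split_ifs <;> rfl
  simp only [this]
  rw [Finset.sum_ite, Finset.sum_const, Finset.sum_const_zero, add_zero, nsmul_eq_mul,
    Fin.card_filter_val_lt, min_eq_right hk]

theorem abs_apply_le_of_amplitudeBounded {n : ℕ} {a : ℝ} {x : Fin n → ℝ}
    (h : AmplitudeBounded a x) (i : Fin n) : |x i| ≤ a :=
  (norm_le_pi_norm x i).trans h

theorem sum_sq_le_of_powerBounded {n : ℕ} (hn : 0 < n) {p : ℝ} {x : Fin n → ℝ}
    (h : PowerBounded p x) : ∑ i, x i ^ 2 ≤ n * p := by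
  unfold PowerBounded at h
  have : (0 : ℝ) < n := by exact_mod_cast hn
  rwa [one_div, inv_mul_le_iff₀ this] at h

namespace SoccScheme

variable {Ka Kd n : ℕ} (S : SoccScheme Ka Kd n)

/-- The noiseless channel output when the first `k` analog transmitters hold `θ`. -/
noncomputable def input (k : ℕ)
    (w : ((j : Fin Kd) → Fin (S.M j)) × (Fin S.L → Set.Icc (-1 : ℝ) 1)) : Fin n → ℝ :=
  ∑ i, S.analogEnc i (repeatFirst Ka k w.2 i) + ∑ j, S.digitalEnc j (w.1 j)

@[fun_prop]
theorem measurable_input (k : ℕ) : Measurable (S.input k) := by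
  unfold input
  refine Measurable.add ?_ ?_
  · refine Finset.measurable_fun_sum _ fun i _ => (S.measurable_analogEnc i).comp ?_
    exact (measurable_pi_apply i).comp ((measurable_repeatFirst Ka k S.L).comp measurable_snd)
  · refine Finset.measurable_fun_sum _ fun j _ => ?_
    exact (Measurable.of_discrete (f := S.digitalEnc j)).comp
      ((measurable_pi_apply j).comp measurable_fst)

theorem outputLaw_repeatFirst (σ : ℝ) (k : ℕ) (m : (j : Fin Kd) → Fin (S.M j))
    (θ : Fin S.L → Set.Icc (-1 : ℝ) 1) :
    S.outputLaw σ (repeatFirst Ka k θ) m = (noiseLaw σ n).map fun z => S.input k (m, θ) + z := by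
  simp [outputLaw, macOutputLaw, input, Fintype.sum_sum_type]

theorem abs_input_le {S : SoccScheme Ka Kd n} {Aa : ℝ} {P A : Fin Kd → ℝ}
    (hS : S.MeetsConstraints Aa P A) (k : ℕ)
    (w : ((j : Fin Kd) → Fin (S.M j)) × (Fin S.L → Set.Icc (-1 : ℝ) 1)) (i : Fin n) :
    |S.input k w i| ≤ Ka * Aa + ∑ j, A j := by
  have h1 : |∑ a, S.analogEnc a (repeatFirst Ka k w.2 a) i| ≤ ∑ _a : Fin Ka, Aa :=
    (Finset.abs_sum_le_sum_abs _ _).trans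
      (Finset.sum_le_sum fun a _ => abs_apply_le_of_amplitudeBounded (hS.1 a _) i)
  have h2 : |∑ j, S.digitalEnc j (w.1 j) i| ≤ ∑ j, A j :=
    (Finset.abs_sum_le_sum_abs _ _).trans
      (Finset.sum_le_sum fun j _ => abs_apply_le_of_amplitudeBounded (hS.2 j _).1 i)
  rw [Finset.sum_const, Finset.card_univ, Fintype.card_fin, nsmul_eq_mul] at h1
  simp only [input, Pi.add_apply, Finset.sum_apply]
  exact (abs_add_le _ _).trans (add_le_add h1 h2)

/-- Joint law of the messages and of the analog values. -/
noncomputable def sourceLaw (J : Finset (Fin Kd)) (m₀ : (j : Fin Kd) → Fin (S.M j)) :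
    Measure (((j : Fin Kd) → Fin (S.M j)) × (Fin S.L → Set.Icc (-1 : ℝ) 1)) :=
  (messageLaw J m₀).prod (Measure.pi fun _ => uniformIcc)

instance isProbabilityMeasure_sourceLaw (J : Finset (Fin Kd)) (m₀ : (j : Fin Kd) → Fin (S.M j)) :
    IsProbabilityMeasure (S.sourceLaw J m₀) := by
  unfold sourceLaw; infer_instance

/-- Frozen messages and analog transmitters holding zeros only shift the input, and a shift is
absorbed in `b`. The centred digital part is independent of the remaining analog part, so their
second moments add; the analog part is bounded by its peak `k * Aa`. -/
theorem exists_sum_integral_input_sub_sq_le {S : SoccScheme Ka Kd n} (hn : 0 < n) {Aa : ℝ}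
    {P A : Fin Kd → ℝ} (hS : S.MeetsConstraints Aa P A) (hAa : 0 ≤ Aa)
    (J : Finset (Fin Kd)) (m₀ : (j : Fin Kd) → Fin (S.M j)) (k : ℕ) :
    ∃ b : Fin n → ℝ, ∑ i, ∫ w, (S.input k w i - b i) ^ 2 ∂(S.sourceLaw J m₀) ≤
      n * (∑ j ∈ J, P j + (k : ℝ) ^ 2 * Aa ^ 2) := by
  set d : Fin n → ((j : Fin Kd) → Fin (S.M j)) → ℝ := fun i m => ∑ j, S.digitalEnc j (m j) i with hd
  set z : Fin S.L → Set.Icc (-1 : ℝ) 1 := fun _ => ⟨0, by norm_num⟩ with hz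
  set a : Fin n → (Fin S.L → Set.Icc (-1 : ℝ) 1) → ℝ := fun i θ =>
    ∑ t : Fin Ka, (if (t : ℕ) < k then S.analogEnc t θ i else 0) with ha
  set c : Fin n → ℝ := fun i =>
    ∑ t : Fin Ka, (if (t : ℕ) < k then 0 else S.analogEnc t z i) with hc
  set μ : Fin n → ℝ := fun i => ∫ m, d i m ∂(messageLaw J m₀) with hμ
  have ham : ∀ i, Measurable (a i) := fun i => by
    refine Finset.measurable_fun_sum _ fun t _ => ?_
    split_ifs
    · exact (measurable_pi_apply i).comp (S.measurable_analogEnc t)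
    · exact measurable_const
  have hab : ∀ i θ, |a i θ| ≤ k * Aa := fun i θ => by
    calc |a i θ| ≤ ∑ t : Fin Ka, (if (t : ℕ) < k then Aa else 0) := by
          refine (Finset.abs_sum_le_sum_abs _ _).trans (Finset.sum_le_sum fun t _ => ?_)
          split_ifs
          · exact abs_apply_le_of_amplitudeBounded (hS.1 t _) i
          · simp
      _ = (min Ka k : ℕ) * Aa := by
          rw [Finset.sum_ite, Finset.sum_const, Finset.sum_const_zero, add_zero, nsmul_eq_mul,
            Fin.card_filter_val_lt]
      _ ≤ k * Aa := by gcongr; exact min_le_right _ _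
  have hin : ∀ i w, S.input k w i - (c i + μ i) = (d i w.1 - μ i) + a i w.2 := by
    intro i w
    have : ∑ t, S.analogEnc t (repeatFirst Ka k w.2 t) i = a i w.2 + c i := by
      rw [ha, hc]
      simp only
      rw [← Finset.sum_add_distrib]
      refine Finset.sum_congr rfl fun t _ => ?_
      unfold repeatFirst
      split_ifs <;> simp [hz]
    simp only [input, Pi.add_apply, Finset.sum_apply, this, hd]
    ring
  -- The mean of `a` need not be subtracted: the cross term already vanishes because `d i - μ i` is
  -- centred.
  refine ⟨fun i => c i + μ i, ?_⟩
  have hone : ∀ i, ∫ w, (S.input k w i - (c i + μ i)) ^ 2 ∂(S.sourceLaw J m₀) ≤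
      ∑ j ∈ J, ∫ x, S.digitalEnc j x i ^ 2 ∂(uniformOrDirac (j ∈ J) (m₀ j)) +
        (k : ℝ) ^ 2 * Aa ^ 2 := by
    intro i
    have i1 : Integrable (fun m => d i m - μ i) (messageLaw J m₀) := Integrable.of_finite
    have i2 : Integrable (fun m => (d i m - μ i) ^ 2) (messageLaw J m₀) := Integrable.of_finite
    have i3 : Integrable (a i) (Measure.pi fun _ : Fin S.L => uniformIcc) :=
      integrable_of_bounded _ (ham i) (hab i)
    have hb2 : ∀ θ, |a i θ ^ 2| ≤ (k * Aa) ^ 2 := fun θ => by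
      rw [abs_pow]; gcongr; exact hab i θ
    have i4 : Integrable (fun θ => a i θ ^ 2) (Measure.pi fun _ : Fin S.L => uniformIcc) :=
      integrable_of_bounded _ ((ham i).pow_const 2) hb2
    have j1 := i2.comp_fst (Measure.pi fun _ : Fin S.L => uniformIcc)
    have j2 := (i1.mul_prod i3).const_mul 2
    have j3 := i4.comp_snd (messageLaw J m₀)
    have hexp : ∀ w : ((j : Fin Kd) → Fin (S.M j)) × (Fin S.L → Set.Icc (-1 : ℝ) 1),
        (S.input k w i - (c i + μ i)) ^ 2 =
        (d i w.1 - μ i) ^ 2 + 2 * ((d i w.1 - μ i) * a i w.2) + a i w.2 ^ 2 := fun w => by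
      rw [hin]; ring
    have j12 : Integrable (fun w : ((j : Fin Kd) → Fin (S.M j)) × (Fin S.L → Set.Icc (-1 : ℝ) 1) =>
        (d i w.1 - μ i) ^ 2 + 2 * ((d i w.1 - μ i) * a i w.2))
        ((messageLaw J m₀).prod (Measure.pi fun _ => uniformIcc)) := j1.add j2
    simp only [hexp]
    rw [sourceLaw, integral_add j12 j3, integral_add j1 j2, integral_const_mul,
      integral_prod_mul (fun m => d i m - μ i) (a i),
      integral_fun_fst (fun m => (d i m - μ i) ^ 2), integral_fun_snd (fun θ => a i θ ^ 2)]
    have e1 : ∫ m, (d i m - μ i) ∂(messageLaw J m₀) = 0 := by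
      rw [integral_sub Integrable.of_finite (integrable_const _)]
      simp [hμ]
    have e2 : ∫ m, (d i m - μ i) ^ 2 ∂(messageLaw J m₀) ≤
        ∑ j ∈ J, ∫ x, S.digitalEnc j x i ^ 2 ∂(uniformOrDirac (j ∈ J) (m₀ j)) := by
      have := variance_sum_messageLaw_le J m₀ fun j x => S.digitalEnc j x i
      rwa [variance_eq_integral Measurable.of_discrete.aemeasurable] at this
    have e3 : ∫ θ, a i θ ^ 2 ∂(Measure.pi fun _ : Fin S.L => uniformIcc) ≤ (k : ℝ) ^ 2 * Aa ^ 2 := by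
      calc _ ≤ ∫ _θ, (k * Aa) ^ 2 ∂(Measure.pi fun _ : Fin S.L => uniformIcc) :=
            integral_mono i4 (integrable_const _) fun θ => (le_abs_self _).trans (hb2 θ)
        _ = _ := by simp [mul_pow]
    simp only [e1, zero_mul, mul_zero, add_zero, probReal_univ, one_smul]
    exact add_le_add e2 e3
  calc _ ≤ ∑ i, (∑ j ∈ J, ∫ x, S.digitalEnc j x i ^ 2 ∂(uniformOrDirac (j ∈ J) (m₀ j)) +
        (k : ℝ) ^ 2 * Aa ^ 2) := Finset.sum_le_sum fun i _ => hone i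
    _ = ∑ j ∈ J, ∫ x, ∑ i, S.digitalEnc j x i ^ 2 ∂(uniformOrDirac (j ∈ J) (m₀ j)) +
        n * ((k : ℝ) ^ 2 * Aa ^ 2) := by
        rw [Finset.sum_add_distrib, Finset.sum_comm]
        simp only [Finset.sum_const, Finset.card_univ, Fintype.card_fin, nsmul_eq_mul]
        congr 1
        refine Finset.sum_congr rfl fun j _ => ?_
        rw [integral_finsetSum _ fun i _ => Integrable.of_finite]
    _ ≤ ∑ j ∈ J, n * P j + n * ((k : ℝ) ^ 2 * Aa ^ 2) := by
        gcongr with j hj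
        calc _ ≤ ∫ _x, n * P j ∂(uniformOrDirac (j ∈ J) (m₀ j)) :=
              integral_mono Integrable.of_finite (integrable_const _) fun x =>
                sum_sq_le_of_powerBounded hn (hS.2 j x).2
          _ = n * P j := by simp
    _ = _ := by rw [← Finset.mul_sum]; ring

/-- The set of message, analog value and noise triples for which decoding succeeds. -/
def correctSet (k : ℕ) :
    Set ((((j : Fin Kd) → Fin (S.M j)) × (Fin S.L → Set.Icc (-1 : ℝ) 1)) × (Fin n → ℝ)) :=
  {p | S.digitalDec (S.input k p.1 + p.2) = p.1.1}

theorem measurableSet_correctSet (k : ℕ) : MeasurableSet (S.correctSet k) :=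
  measurableSet_eq_fun (S.measurable_digitalDec.comp (by fun_prop)) (by fun_prop)

/-- Any score of the analog values whose exponential has mean at most one for every channel output
competes with the sum rate of the messages for the capacity of the channel. -/
theorem correct_mul_log_add_integral_le {S : SoccScheme Ka Kd n} (hn : 0 < n) {σ Aa : ℝ}
    (hσ : 0 < σ) {P A : Fin Kd → ℝ} (hS : S.MeetsConstraints Aa P A) (hAa : 0 ≤ Aa)
    (hP : ∀ j, 0 ≤ P j)
    (J : Finset (Fin Kd)) (m₀ : (j : Fin Kd) → Fin (S.M j)) (k : ℕ)
    (g : (Fin S.L → Set.Icc (-1 : ℝ) 1) → (Fin n → ℝ) → ℝ) (hg : Measurable (Function.uncurry g))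
    (hexp : ∀ y, ∫⁻ θ, ENNReal.ofReal (Real.exp (g θ y)) ∂(Measure.pi fun _ => uniformIcc) ≤ 1)
    (hint : Integrable (fun p : (((j : Fin Kd) → Fin (S.M j)) × (Fin S.L → Set.Icc (-1 : ℝ) 1)) ×
      (Fin n → ℝ) => g p.1.2 (S.input k p.1 + p.2)) ((S.sourceLaw J m₀).prod (noiseLaw σ n))) :
    ((S.sourceLaw J m₀).prod (noiseLaw σ n)).real (S.correctSet k) *
        Real.log (∏ j ∈ J, (S.M j : ℝ)) +
      ∫ p, g p.1.2 (S.input k p.1 + p.2) ∂((S.sourceLaw J m₀).prod (noiseLaw σ n)) ≤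
      Real.log 2 +
        n * gaussianCapacity ((∑ j ∈ J, P j + (k : ℝ) ^ 2 * Aa ^ 2) / σ ^ 2) := by
  obtain ⟨b, hb⟩ := exists_sum_integral_input_sub_sq_le hn hS hAa J m₀ k
  set r := Real.log (∏ j ∈ J, (S.M j : ℝ)) with hr
  set score : ((j : Fin Kd) → Fin (S.M j)) × (Fin S.L → Set.Icc (-1 : ℝ) 1) → (Fin n → ℝ) → ℝ :=
    fun w y => (if S.digitalDec y = w.1 then r else 0) + g w.2 y with hscore
  have hdecm : Measurable fun p : (((j : Fin Kd) → Fin (S.M j)) ×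
      (Fin S.L → Set.Icc (-1 : ℝ) 1)) × (Fin n → ℝ) =>
      (if S.digitalDec p.2 = p.1.1 then r else 0) :=
    Measurable.ite (measurableSet_eq_fun (S.measurable_digitalDec.comp (by fun_prop))
      (by fun_prop)) measurable_const measurable_const
  have hsm : Measurable (Function.uncurry score) :=
    hdecm.add (hg.comp (f := fun p : (((j : Fin Kd) → Fin (S.M j)) ×
      (Fin S.L → Set.Icc (-1 : ℝ) 1)) × (Fin n → ℝ) => (p.1.2, p.2)) (by fun_prop))
  have hind : ∀ p : (((j : Fin Kd) → Fin (S.M j)) × (Fin S.L → Set.Icc (-1 : ℝ) 1)) ×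
      (Fin n → ℝ), (if S.digitalDec (S.input k p.1 + p.2) = p.1.1 then r else 0) =
      (S.correctSet k).indicator (fun _ => r) p := fun p => by
    by_cases h : S.digitalDec (S.input k p.1 + p.2) = p.1.1
    · rw [if_pos h, Set.indicator_of_mem (show p ∈ S.correctSet k from h)]
    · rw [if_neg h, Set.indicator_of_notMem (show p ∉ S.correctSet k from h)]
  have hindi : Integrable ((S.correctSet k).indicator (fun _ => r))
      ((S.sourceLaw J m₀).prod (noiseLaw σ n)) :=
    (integrable_const r).indicator (S.measurableSet_correctSet k)
  have key := integral_score_le (S.sourceLaw J m₀) hσ (S.input k) (S.measurable_input k)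
    (abs_input_le hS k) b (P := ∑ j ∈ J, P j + (k : ℝ) ^ 2 * Aa ^ 2)
    (add_nonneg (Finset.sum_nonneg fun j _ => hP j) (by positivity)) hb score hsm
    (C := 2) two_pos ?_ ?_
  · have e : ∫ p, score p.1 (S.input k p.1 + p.2) ∂((S.sourceLaw J m₀).prod (noiseLaw σ n)) =
        ((S.sourceLaw J m₀).prod (noiseLaw σ n)).real (S.correctSet k) * r +
        ∫ p, g p.1.2 (S.input k p.1 + p.2) ∂((S.sourceLaw J m₀).prod (noiseLaw σ n)) := by
      simp only [hscore, hind]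
      rw [integral_add hindi hint, integral_indicator_const _ (S.measurableSet_correctSet k),
        smul_eq_mul]
    rw [← e]
    exact key
  · intro y
    have hgy : Measurable fun θ => g θ y := hg.comp (measurable_prodMk_right (y := y))
    -- For a fixed output, messages and analog values are independent under `sourceLaw`, so the
    -- exponential moment factors into at most `2 * 1`.
    simp only [hscore, Real.exp_add, ENNReal.ofReal_mul (Real.exp_pos _).le]
    rw [sourceLaw, lintegral_prod_mul
      (f := fun m => ENNReal.ofReal (Real.exp (if S.digitalDec y = m then r else 0)))
      (g := fun θ => ENNReal.ofReal (Real.exp (g θ y)))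
      Measurable.of_discrete.aemeasurable (by fun_prop)]
    calc _ ≤ (2 : ℝ≥0∞) * 1 := by
          gcongr
          · exact lintegral_exp_indicator_messageLaw_le J m₀ (S.digitalDec y)
          · exact hexp y
      _ = _ := by simp
  · simp only [hscore, hind]
    exact hindi.add hint

end SoccScheme

namespace SoccScheme

variable {Ka Kd n : ℕ} (S : SoccScheme Ka Kd n)

/-- For suitable fixed messages outside `J` the decoder succeeds with high probability. -/
theorem exists_le_prob_correctSet {σ ε : ℝ} (hS : ∀ s, S.digitalError σ s ≤ ε)
    (J : Finset (Fin Kd)) (k : ℕ) :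
    ∃ m₀, 1 - ε ≤ ((S.sourceLaw J m₀).prod (noiseLaw σ n)).real (S.correctSet k) := by
  have (j : Fin Kd) : NeZero (S.M j) := ⟨(S.digitalDec 0 j).pos.ne'⟩
  have hmeas := (S.measurableSet_correctSet k).compl
  set F : (((j : Fin Kd) → Fin (S.M j)) × (Fin S.L → Set.Icc (-1 : ℝ) 1)) × (Fin n → ℝ) → ℝ :=
    (S.correctSet k)ᶜ.indicator (fun _ => 1) with hF
  have hFm : StronglyMeasurable F := stronglyMeasurable_const.indicator hmeas
  have hFi (m₀) : Integrable F ((S.sourceLaw J m₀).prod (noiseLaw σ n)) :=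
    (integrable_const 1).indicator hmeas
  have herr : ∀ m θ, (S.outputLaw σ (repeatFirst Ka k θ) m).real {y | S.digitalDec y ≠ m} =
      ∫ z, F ((m, θ), z) ∂(noiseLaw σ n) := by
    intro m θ
    have hms : MeasurableSet {y | S.digitalDec y ≠ m} :=
      (S.measurable_digitalDec (measurableSet_singleton m)).compl
    rw [outputLaw_repeatFirst, map_measureReal_apply (by fun_prop) hms,
      ← integral_indicator_one (hms.preimage (by fun_prop))]
    rfl
  have hint : ∀ m, Integrable (fun θ => ∫ z, F ((m, θ), z) ∂(noiseLaw σ n))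
      (Measure.pi fun _ : Fin S.L => uniformIcc) := by
    intro m
    have h1 : StronglyMeasurable fun w => ∫ z, F (w, z) ∂(noiseLaw σ n) :=
      hFm.integral_prod_right'
    refine integrable_of_bounded _ (B := 1)
      (h1.measurable.comp (measurable_prodMk_left (x := m))) fun θ => ?_
    rw [← herr, abs_of_nonneg measureReal_nonneg, outputLaw_repeatFirst]
    have := Measure.isProbabilityMeasure_map (μ := noiseLaw σ n)
      (f := fun z => S.input k (m, θ) + z) (by fun_prop)
    exact measureReal_le_one
  -- The error bound holds for every analog input, so it survives averaging over `θ`; only then are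
  -- the messages outside `J` frozen.
  obtain ⟨m₀, hm₀⟩ := exists_integral_messageLaw_le J
    (fun m => ∫ θ, ∫ z, F ((m, θ), z) ∂(noiseLaw σ n) ∂(Measure.pi fun _ : Fin S.L => uniformIcc))
    (ε := ε) (by
      rw [← integral_finsetSum _ fun m _ => hint m, ← integral_const_mul]
      calc _ ≤ ∫ _θ, ε ∂(Measure.pi fun _ : Fin S.L => uniformIcc) := by
            refine integral_mono ((integrable_finsetSum _ fun m _ => hint m).const_mul _)
              (integrable_const _) fun θ => ?_
            have := hS (repeatFirst Ka k θ)
            simpa only [digitalError, herr] using this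
        _ = ε := by simp)
  refine ⟨m₀, ?_⟩
  have h2 : ((S.sourceLaw J m₀).prod (noiseLaw σ n)).real (S.correctSet k)ᶜ ≤ ε := by
    rw [← integral_indicator_one hmeas]
    change ∫ p, F p ∂_ ≤ ε
    rw [integral_prod _ (hFi m₀), sourceLaw, integral_prod _ (hFi m₀).integral_prod_left]
    exact hm₀
  rw [probReal_compl_eq_one_sub (S.measurableSet_correctSet k)] at h2
  linarith

theorem measurable_approximationError (k : ℕ) (ℓ : Fin S.L) :
    Measurable fun q : (Fin S.L → Set.Icc (-1 : ℝ) 1) × (Fin n → ℝ) =>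
      ((k : ℝ) * q.1 ℓ - S.analogDec q.2 ℓ) ^ 2 := by
  have h1 : Measurable fun q : (Fin S.L → Set.Icc (-1 : ℝ) 1) × (Fin n → ℝ) =>
      S.analogDec q.2 ℓ :=
    (measurable_pi_apply ℓ).comp (S.measurable_analogDec.comp measurable_snd)
  fun_prop

/-- Under `repeatFirst` the sum to be estimated is `k * θ ℓ`, and the worst-case bound can be
averaged over messages and `θ`. Its finiteness also supplies the integrability of the analog score.
-/
theorem integral_approximationError_le {σ V : ℝ} (hV : 0 ≤ V) (hS : S.ApproximatesSums σ V)
    (J : Finset (Fin Kd)) (m₀ : (j : Fin Kd) → Fin (S.M j)) {k : ℕ} (hk : k ≤ Ka) (ℓ : Fin S.L) :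
    Integrable (fun p : (((j : Fin Kd) → Fin (S.M j)) × (Fin S.L → Set.Icc (-1 : ℝ) 1)) ×
      (Fin n → ℝ) => ((k : ℝ) * p.1.2 ℓ - S.analogDec (S.input k p.1 + p.2) ℓ) ^ 2)
      ((S.sourceLaw J m₀).prod (noiseLaw σ n)) ∧
    ∫ p, ((k : ℝ) * p.1.2 ℓ - S.analogDec (S.input k p.1 + p.2) ℓ) ^ 2
      ∂((S.sourceLaw J m₀).prod (noiseLaw σ n)) ≤ V := by
  have hm : Measurable (fun p : (((j : Fin Kd) → Fin (S.M j)) ×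
      (Fin S.L → Set.Icc (-1 : ℝ) 1)) × (Fin n → ℝ) =>
      ((k : ℝ) * p.1.2 ℓ - S.analogDec (S.input k p.1 + p.2) ℓ) ^ 2) :=
    (S.measurable_approximationError k ℓ).comp
      (f := fun p : (((j : Fin Kd) → Fin (S.M j)) × (Fin S.L → Set.Icc (-1 : ℝ) 1)) ×
        (Fin n → ℝ) => (p.1.2, S.input k p.1 + p.2)) (by fun_prop)
  have hle : ∫⁻ p, ENNReal.ofReal
      (((k : ℝ) * p.1.2 ℓ - S.analogDec (S.input k p.1 + p.2) ℓ) ^ 2)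
      ∂((S.sourceLaw J m₀).prod (noiseLaw σ n)) ≤ ENNReal.ofReal V := by
    rw [lintegral_prod _ hm.ennreal_ofReal.aemeasurable]
    calc _ ≤ ∫⁻ _w, ENNReal.ofReal V ∂(S.sourceLaw J m₀) := by
          refine lintegral_mono fun w => ?_
          have h := hS ℓ (repeatFirst Ka k w.2) w.1
          have hm' : Measurable fun y : Fin n → ℝ =>
              ENNReal.ofReal (((k : ℝ) * w.2 ℓ - S.analogDec y ℓ) ^ 2) :=
            ((S.measurable_approximationError k ℓ).comp
              (measurable_prodMk_left (x := w.2))).ennreal_ofReal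
          rw [outputLaw_repeatFirst, sum_repeatFirst hk, lintegral_map hm' (by fun_prop)] at h
          exact h
      _ = _ := by simp
  refine ⟨⟨hm.aestronglyMeasurable, ?_⟩, ?_⟩
  · rw [hasFiniteIntegral_iff_ofReal (ae_of_all _ fun p => sq_nonneg _)]
    exact hle.trans_lt ENNReal.ofReal_lt_top
  · rw [integral_eq_lintegral_of_nonneg_ae (ae_of_all _ fun p => sq_nonneg _)
      hm.aestronglyMeasurable]
    exact ENNReal.toReal_le_of_le_ofReal hV hle

/-- Converse for a single block. -/
theorem sum_log_add_le {S : SoccScheme Ka Kd n} (hn : 0 < n) {σ Aa V ε : ℝ} (hσ : 0 < σ)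
    {P A : Fin Kd → ℝ} (hAa : 0 ≤ Aa) (hP : ∀ j, 0 ≤ P j) (hV : 0 < V)
    (hS : S.MeetsConstraints Aa P A) (hS' : ∀ s, S.digitalError σ s ≤ ε)
    (hS'' : S.ApproximatesSums σ V) (J : Finset (Fin Kd)) {k : ℕ} (hk : k ≤ Ka) :
    (1 - ε) * ∑ j ∈ J, Real.log (S.M j) +
      max (S.L / 2 * Real.log (2 * (k : ℝ) ^ 2 / (Real.pi * Real.exp 1 * V))) 0 ≤
      Real.log 2 +
        n * gaussianCapacity ((∑ j ∈ J, P j + (k : ℝ) ^ 2 * Aa ^ 2) / σ ^ 2) := by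
  obtain ⟨m₀, hm₀⟩ := S.exists_le_prob_correctSet hS' J k
  have hM : ∀ j, (S.M j : ℝ) ≠ 0 := fun j => by
    have := (m₀ j).pos
    positivity
  have hsum0 : 0 ≤ ∑ j ∈ J, Real.log (S.M j) :=
    Finset.sum_nonneg fun j _ => Real.log_natCast_nonneg _
  have hmul := mul_le_mul_of_nonneg_right hm₀ hsum0
  rw [← Real.log_prod fun j _ => hM j] at hmul ⊢
  rw [← le_sub_iff_add_le', max_le_iff]
  constructor
  -- For `k = 0` the logarithm is `Real.log 0 = 0`, so the zero score suffices; the Gaussian score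
  -- needs `k > 0`.
  · rcases Nat.eq_zero_or_pos k with rfl | hk0
    · have := correct_mul_log_add_integral_le hn hσ hS hAa hP J m₀ 0 (fun _ _ => 0)
        measurable_const (by simp) (integrable_const _)
      rw [integral_zero] at this
      simp only [Nat.cast_zero] at this ⊢
      norm_num at this ⊢
      linarith
    have hk' : (0 : ℝ) < k := by exact_mod_cast hk0
    set c := 1 / 2 * Real.log (2 * (k : ℝ) ^ 2 / (Real.pi * V)) with hc
    have happ := fun ℓ => S.integral_approximationError_le hV.le hS'' J m₀ hk ℓ
    have hcℓ : ∀ ℓ, Integrable (fun p : (((j : Fin Kd) → Fin (S.M j)) ×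
        (Fin S.L → Set.Icc (-1 : ℝ) 1)) × (Fin n → ℝ) =>
        c - ((k : ℝ) * p.1.2 ℓ - S.analogDec (S.input k p.1 + p.2) ℓ) ^ 2 / (2 * V))
        ((S.sourceLaw J m₀).prod (noiseLaw σ n)) := fun ℓ =>
      (integrable_const c).sub ((happ ℓ).1.div_const _)
    have key := correct_mul_log_add_integral_le hn hσ hS hAa hP J m₀ k
      (fun θ y => ∑ ℓ, (c - ((k : ℝ) * θ ℓ - S.analogDec y ℓ) ^ 2 / (2 * V)))
      (Finset.measurable_fun_sum _ fun ℓ _ =>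
        ((S.measurable_approximationError k ℓ).div_const _).const_sub c)
      (fun y => by
        simp only [Real.exp_sum, ENNReal.ofReal_prod_of_nonneg fun i _ => (Real.exp_pos _).le]
        rw [lintegral_pi_prod_eq (fun _ : Fin S.L => uniformIcc)
          (fun ℓ t => ENNReal.ofReal (Real.exp
            (c - ((k : ℝ) * t - S.analogDec y ℓ) ^ 2 / (2 * V)))) (fun ℓ => by fun_prop)]
        exact Finset.prod_le_one' fun ℓ _ => lintegral_exp_score_uniformIcc_le hk' hV _)
      (integrable_finsetSum _ fun ℓ _ => hcℓ ℓ)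
    have hlow : S.L / 2 * Real.log (2 * (k : ℝ) ^ 2 / (Real.pi * Real.exp 1 * V)) ≤
        ∫ p : (((j : Fin Kd) → Fin (S.M j)) × (Fin S.L → Set.Icc (-1 : ℝ) 1)) × (Fin n → ℝ),
          ∑ ℓ, (c - ((k : ℝ) * p.1.2 ℓ - S.analogDec (S.input k p.1 + p.2) ℓ) ^ 2 / (2 * V))
          ∂((S.sourceLaw J m₀).prod (noiseLaw σ n)) := by
      rw [integral_finsetSum _ fun ℓ _ => hcℓ ℓ]
      -- The `e` in the denominator is the loss `V / (2V) = 1/2` from the squared error term.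
      have hl : Real.log (2 * (k : ℝ) ^ 2 / (Real.pi * Real.exp 1 * V)) = 2 * c - 1 := by
        rw [hc, show 2 * (k : ℝ) ^ 2 / (Real.pi * Real.exp 1 * V) =
          2 * (k : ℝ) ^ 2 / (Real.pi * V) / Real.exp 1 by field_simp,
          Real.log_div (by positivity) (by positivity), Real.log_exp]
        ring
      calc _ = ∑ _ℓ : Fin S.L, (c - V / (2 * V)) := by
            rw [hl, Finset.sum_const, Finset.card_univ, Fintype.card_fin, nsmul_eq_mul]
            field_simp
        _ ≤ _ := by
            refine Finset.sum_le_sum fun ℓ _ => ?_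
            rw [integral_sub (integrable_const _) ((happ ℓ).1.div_const _), integral_div]
            simp only [integral_const, probReal_univ, one_smul]
            gcongr
            exact (happ ℓ).2
    linarith
  · have := correct_mul_log_add_integral_le hn hσ hS hAa hP J m₀ k (fun _ _ => 0)
      measurable_const (by simp) (integrable_const _)
    rw [integral_zero] at this
    linarith

end SoccScheme

/-! ### The outer bound in the limit of long blocks -/

theorem isClosed_soccOuter (Ka : ℕ) {Kd : ℕ} (σ Aa : ℝ) (P : Fin Kd → ℝ) (β V : ℝ) :
    IsClosed (soccOuter Ka σ Aa P β V) := by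
  rw [soccOuter, Set.ofPred_forall]
  exact isClosed_iInter fun J => isClosed_le (by fun_prop) continuous_const

theorem soccAchievable_subset_soccOuter (Ka : ℕ) {Kd : ℕ} {σ Aa : ℝ} {P A : Fin Kd → ℝ} {β V : ℝ}
    (hσ : 0 < σ) (hAa : 0 ≤ Aa) (hP : ∀ k, 0 ≤ P k) (hβ : 0 ≤ β) (hV : 0 < V) {R : Fin Kd → ℝ}
    (hR : SoccAchievable Ka σ Aa P A β V R) : R ∈ soccOuter Ka σ Aa P β V := by
  obtain ⟨-, S, hrate, hL, hcon, herr, happ⟩ := hR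
  intro J
  rw [Finset.le_inf'_iff]
  intro k hk
  rw [Finset.mem_range, Nat.lt_succ_iff] at hk
  set C := gaussianCapacity ((∑ j ∈ J, P j + (k : ℝ) ^ 2 * Aa ^ 2) / σ ^ 2) with hC
  set ℓ := Real.log (2 * (k : ℝ) ^ 2 / (Real.pi * Real.exp 1 * V)) with hℓ
  have hblock : ∀ ε > 0, ε < 1 → (1 - ε) * ∑ j ∈ J, R j + max (β / 2 * ℓ) 0 ≤ C := by
    intro ε hε hε1
    have hev : ∀ᶠ n : ℕ in atTop,
        (1 - ε) * ∑ j ∈ J, R j + max (β / 2 * ℓ) 0 ≤ Real.log 2 / n + C := by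
      filter_upwards [herr ε hε, happ, eventually_gt_atTop 0] with n h1 h2 hn
      have hn' : (0 : ℝ) < n := by exact_mod_cast hn
      have h := SoccScheme.sum_log_add_le hn hσ hAa hP hV (hcon n hn) h1 h2 J hk
      have hsum : n * ∑ j ∈ J, R j ≤ ∑ j ∈ J, Real.log ((S n).M j) := by
        rw [Finset.mul_sum]
        refine Finset.sum_le_sum fun j _ => ?_
        have := hrate n hn j
        rwa [le_div_iff₀' hn'] at this
      have hmax : n * max (β / 2 * ℓ) 0 ≤ max ((S n).L / 2 * ℓ) 0 := by
        have hLn := hL n hn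
        rw [le_div_iff₀ hn'] at hLn
        rw [mul_max_of_nonneg _ _ hn'.le, mul_zero]
        -- The bound `β n ≤ L` helps only for a nonnegative logarithm; otherwise the left-hand
        -- maximum is `0`.
        rcases le_total ℓ 0 with h0 | h0
        · refine max_le (le_max_of_le_right ?_) (le_max_right _ _)
          exact mul_nonpos_of_nonneg_of_nonpos hn'.le
            (mul_nonpos_of_nonneg_of_nonpos (by positivity) h0)
        · refine max_le_max ?_ le_rfl
          nlinarith
      have := mul_le_mul_of_nonneg_left hsum (sub_nonneg.2 hε1.le)
      rw [div_add' _ _ _ hn'.ne', le_div_iff₀ hn']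
      nlinarith
    have hlim : Tendsto (fun n : ℕ => Real.log 2 / n + C) atTop (𝓝 (0 + C)) :=
      (tendsto_const_div_atTop_nhds_zero_nat _).add tendsto_const_nhds
    rw [zero_add] at hlim
    exact ge_of_tendsto hlim hev
  have hlim : Tendsto (fun ε : ℝ => (1 - ε) * ∑ j ∈ J, R j + max (β / 2 * ℓ) 0) (𝓝[>] 0)
      (𝓝 ((1 - 0) * ∑ j ∈ J, R j + max (β / 2 * ℓ) 0)) := by
    refine Tendsto.mono_left (Continuous.tendsto ?_ _) nhdsWithin_le_nhds
    fun_prop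
  have hfin : (1 - 0) * ∑ j ∈ J, R j + max (β / 2 * ℓ) 0 ≤ C := by
    refine le_of_tendsto hlim ?_
    filter_upwards [Ioo_mem_nhdsGT (zero_lt_one' ℝ)] with ε hε using hblock ε hε.1 hε.2
  linarith

theorem soccCapacity_subset_soccOuter (Ka : ℕ) {Kd : ℕ} {σ Aa : ℝ} {P A : Fin Kd → ℝ} {β V : ℝ}
    (hσ : 0 < σ) (hAa : 0 ≤ Aa) (hP : ∀ k, 0 ≤ P k) (hβ : 0 ≤ β) (hV : 0 < V) :
    soccCapacity Ka σ Aa P A β V ⊆ soccOuter Ka σ Aa P β V :=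
  closure_minimal (fun _ hR => soccAchievable_subset_soccOuter Ka hσ hAa hP hβ hV hR)
    (isClosed_soccOuter Ka σ Aa P β V)

/-! ### Zero-sum isometries with small row sums -/

/-- The rows of `u` are orthonormal. -/
def OrthonormalRows {κ ι : Type*} [Fintype ι] [DecidableEq κ] (u : κ → ι → ℝ) : Prop :=
  ∀ j j', ∑ i, u j i * u j' i = if j = j' then 1 else 0

theorem OrthonormalRows.sum_sq_vecMul {κ ι : Type*} [Fintype ι] [Fintype κ] [DecidableEq κ]
    {u : κ → ι → ℝ} (h : OrthonormalRows u) (x : κ → ℝ) :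
    ∑ i, (∑ j, x j * u j i) ^ 2 = ∑ j, x j ^ 2 := by
  calc ∑ i, (∑ j, x j * u j i) ^ 2
      = ∑ i, ∑ j, ∑ j', x j * x j' * (u j i * u j' i) := by
        refine Finset.sum_congr rfl fun i _ => ?_
        rw [sq, Finset.sum_mul_sum]
        refine Finset.sum_congr rfl fun j _ => Finset.sum_congr rfl fun j' _ => by ring
    _ = ∑ j, ∑ j', x j * x j' * ∑ i, u j i * u j' i := by
        rw [Finset.sum_comm]
        refine Finset.sum_congr rfl fun j _ => ?_
        rw [Finset.sum_comm]
        simp only [Finset.mul_sum]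
    _ = _ := by simp [h _ _, sq]

theorem OrthonormalRows.mulVec_vecMul {κ ι : Type*} [Fintype ι] [Fintype κ] [DecidableEq κ]
    {u : κ → ι → ℝ} (h : OrthonormalRows u) (x : κ → ℝ) (j : κ) :
    ∑ i, u j i * ∑ j', x j' * u j' i = x j := by
  simp only [Finset.mul_sum]
  rw [Finset.sum_comm]
  have : ∀ j', ∑ i, u j i * (x j' * u j' i) = x j' * ∑ i, u j i * u j' i := fun j' => by
    rw [Finset.mul_sum]; exact Finset.sum_congr rfl fun i _ => by ring
  simp [this, h _ _]

/-- There is an orthonormal family of `κ` zero-sum vectors in `ℝ^ι` whose absolute values sum, in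
each coordinate, to at most `B`. -/
def HasBalancedFamily (κ ι : Type*) [Fintype ι] [Fintype κ] [DecidableEq κ] (B : ℝ) : Prop :=
  ∃ u : κ → ι → ℝ, OrthonormalRows u ∧ (∀ j, ∑ i, u j i = 0) ∧ ∀ i, ∑ j, |u j i| ≤ B

theorem HasBalancedFamily.congr {κ ι κ' ι' : Type*} [Fintype ι] [Fintype κ] [DecidableEq κ]
    [Fintype ι'] [Fintype κ'] [DecidableEq κ'] {B : ℝ} (h : HasBalancedFamily κ ι B)
    (e : κ' ≃ κ) (f : ι' ≃ ι) : HasBalancedFamily κ' ι' B := by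
  obtain ⟨u, h1, h2, h3⟩ := h
  refine ⟨fun j i => u (e j) (f i), fun j j' => ?_, fun j => ?_, fun i => ?_⟩
  · rw [f.sum_comp fun i => u (e j) i * u (e j') i, h1]
    simp
  · rw [f.sum_comp fun i => u (e j) i, h2]
  · rw [e.sum_comp fun j => |u j (f i)|]
    exact h3 _

/-- Haar-type step: two families are joined by one vector that is constant on each part. -/
theorem HasBalancedFamily.sum {κ₁ ι₁ κ₂ ι₂ : Type*} [Fintype ι₁] [Fintype κ₁] [DecidableEq κ₁]
    [Fintype ι₂] [Fintype κ₂] [DecidableEq κ₂] {B₁ B₂ B p q : ℝ}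
    (h₁ : HasBalancedFamily κ₁ ι₁ B₁) (h₂ : HasBalancedFamily κ₂ ι₂ B₂)
    (hsum : Fintype.card ι₁ * p = Fintype.card ι₂ * q)
    (hsq : Fintype.card ι₁ * p ^ 2 + Fintype.card ι₂ * q ^ 2 = 1)
    (hp : 0 ≤ p) (hq : 0 ≤ q) (hB₁ : B₁ + p ≤ B) (hB₂ : B₂ + q ≤ B) :
    HasBalancedFamily ((κ₁ ⊕ κ₂) ⊕ Unit) (ι₁ ⊕ ι₂) B := by
  obtain ⟨u, u1, u2, u3⟩ := h₁
  obtain ⟨v, v1, v2, v3⟩ := h₂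
  refine ⟨Sum.elim (Sum.elim (fun j => Sum.elim (u j) 0) (fun j => Sum.elim 0 (v j)))
    (fun _ => Sum.elim (fun _ => p) (fun _ => -q)), ?_, ?_, ?_⟩
  · rintro ((j | j) | j) ((j' | j') | j') <;>
      simp [u1 _ _, v1 _ _, ← Finset.sum_mul, ← Finset.mul_sum, u2, v2]
    linarith
  · rintro ((j | j) | j) <;> simp [u2, v2]
    linarith
  · rintro (i | i) <;> simp [abs_of_nonneg hp, abs_of_nonneg hq]
    · linarith [u3 i]
    · linarith [v3 i]

/-- From `(√m - √a)(√m + √a) = b` and `√m + √a ≤ (2 + √2) √b` one gets `√b ≤ (2 + √2)(√m - √a)`;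
this is the claim after division by `√a √m`. The shape `1 - 1/√N` makes the recursion telescope to a
bound free of `N`. -/
theorem splitting_bound {a b m : ℝ} (ha : 0 < a) (hb : 0 < b) (hm : m = a + b) (hab : a ≤ 2 * b) :
    (2 + √2) * (1 - 1 / √a) + √(b / (a * m)) ≤ (2 + √2) * (1 - 1 / √m) := by
  have hm0 : 0 < m := by linarith
  have sa : 0 < √a := by positivity
  have sb : 0 < √b := by positivity
  have sm : 0 < √m := by positivity
  have h1 : √a ≤ √2 * √b := by
    rw [← Real.sqrt_mul (by norm_num)]; exact Real.sqrt_le_sqrt hab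
  have h2 : √m ≤ 2 * √b := by
    rw [show (2 : ℝ) * √b = √(4 * b) by
      rw [Real.sqrt_mul (by norm_num), show (4 : ℝ) = 2 ^ 2 by norm_num,
        Real.sqrt_sq (by norm_num)]]
    exact Real.sqrt_le_sqrt (by linarith)
  have h3 : √b ≤ (2 + √2) * (√m - √a) := by
    have e : (√m - √a) * (√m + √a) = √b * √b := by
      have := Real.mul_self_sqrt hm0.le
      have := Real.mul_self_sqrt ha.le
      have := Real.mul_self_sqrt hb.le
      nlinarith
    have hpos : 0 < √m + √a := by positivity
    have h4 : √b * (√m + √a) ≤ ((2 + √2) * (√m - √a)) * (√m + √a) := by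
      rw [mul_assoc, e]
      nlinarith
    exact le_of_mul_le_mul_right h4 hpos
  have e1 : √(b / (a * m)) = √b / (√a * √m) := by
    rw [Real.sqrt_div hb.le, Real.sqrt_mul ha.le]
  have e2 : (2 + √2) * (1 - 1 / √m) - (2 + √2) * (1 - 1 / √a) =
      (2 + √2) * (√m - √a) / (√a * √m) := by
    field_simp
    ring
  have : √b / (√a * √m) ≤ (2 + √2) * (√m - √a) / (√a * √m) := by gcongr
  rw [e1]
  linarith

/-- Recursive halving: the vector added at a split has entries of order `1/√N`, and these form a
geometric-type sum along the chain of parts containing a coordinate. -/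
theorem hasBalancedFamily_fin (N : ℕ) (hN : 0 < N) :
    HasBalancedFamily (Fin (N - 1)) (Fin N) ((2 + √2) * (1 - 1 / √N)) := by
  induction N using Nat.strong_induction_on with
  | _ N ih =>
    rcases Nat.lt_or_ge N 2 with h | h
    · obtain rfl : N = 1 := by omega
      refine ⟨fun j => j.elim0, fun j => j.elim0, fun j => j.elim0, fun i => by simp⟩
    · obtain ⟨a, b, hN', hb, hab, hba⟩ : ∃ a b, N = a + b ∧ 0 < b ∧ a ≤ 2 * b ∧ b ≤ a :=
        ⟨N - N / 2, N / 2, by omega, by omega, by omega, by omega⟩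
      have ha : 0 < a := by omega
      have haR : (0 : ℝ) < a := by exact_mod_cast ha
      have hbR : (0 : ℝ) < b := by exact_mod_cast hb
      have hNR : (N : ℝ) = a + b := by exact_mod_cast hN'
      have hab' : (a : ℝ) ≤ 2 * b := by exact_mod_cast hab
      have hba' : (b : ℝ) ≤ 2 * a := by
        have : (b : ℝ) ≤ a := by exact_mod_cast hba
        linarith
      have hN0 : (0 : ℝ) < N := by rw [hNR]; positivity
      have key := (ih a (by omega) ha).sum (ih b (by omega) hb)
        -- These are the nonnegative solutions of `a p = b q` (zero sum) and `a p² + b q² = 1` (unit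
        -- norm).
        (p := √((b : ℝ) / (a * N))) (q := √((a : ℝ) / (b * N)))
        (B := (2 + √2) * (1 - 1 / √N)) ?_ ?_ (by positivity) (by positivity)
        (splitting_bound haR hbR hNR hab')
        (splitting_bound hbR haR (by rw [hNR, add_comm]) hba')
      · refine key.congr (Fintype.equivOfCardEq ?_) (Fintype.equivOfCardEq ?_)
        · simp; omega
        · simp [hN']
      · simp only [Fintype.card_fin]
        rw [Real.sqrt_div hbR.le, Real.sqrt_div haR.le, Real.sqrt_mul haR.le, Real.sqrt_mul hbR.le]
        have := Real.mul_self_sqrt haR.le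
        have := Real.mul_self_sqrt hbR.le
        field_simp
        nlinarith
      · simp only [Fintype.card_fin]
        rw [Real.sq_sqrt (by positivity), Real.sq_sqrt (by positivity)]
        field_simp
        linarith

/-- An orthonormal family of `n - q` vectors in `ℝⁿ` that sum to zero over each of `q` disjoint
blocks of length `N`. -/
theorem exists_blockwise_family {n q N : ℕ} (hN : 0 < N) (hq : q * N ≤ n) :
    ∃ (e : Fin n ≃ (Fin q × Fin N) ⊕ Fin (n - q * N)) (U : Fin (n - q) → Fin n → ℝ),
      OrthonormalRows U ∧ (∀ j ℓ, ∑ t, U j (e.symm (Sum.inl (ℓ, t))) = 0) ∧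
      ∀ i, ∑ j, |U j i| ≤ 2 + √2 := by
  obtain ⟨u, u1, u2, u3⟩ := hasBalancedFamily_fin N hN
  have hqN : q ≤ q * N := Nat.le_mul_of_pos_right q hN
  let e : Fin n ≃ (Fin q × Fin N) ⊕ Fin (n - q * N) := Fintype.equivOfCardEq (by simp; omega)
  let f : Fin (n - q) ≃ (Fin q × Fin (N - 1)) ⊕ Fin (n - q * N) := Fintype.equivOfCardEq (by
    simp [Nat.mul_sub]; omega)
  -- A copy of the balanced family on each block and unit vectors on the leftover coordinates: `q (N
  -- - 1) + (n - q N) = n - q` vectors.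
  let W : (Fin q × Fin (N - 1)) ⊕ Fin (n - q * N) → (Fin q × Fin N) ⊕ Fin (n - q * N) → ℝ :=
    Sum.elim (fun j => Sum.elim (fun i => if j.1 = i.1 then u j.2 i.2 else 0) 0)
      (fun j => Sum.elim 0 (fun i => if j = i then 1 else 0))
  refine ⟨e, fun j i => W (f j) (e i), fun j j' => ?_, fun j ℓ => ?_, fun i => ?_⟩
  · rw [e.sum_comp fun i => W (f j) i * W (f j') i]
    have hW : ∀ j j', ∑ i, W j i * W j' i = if j = j' then 1 else 0 := by
      rintro (⟨x, j⟩ | j) (⟨x', j'⟩ | j') <;>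
        simp [W, Fintype.sum_prod_type, u1 _ _]
      split_ifs <;> simp_all
    rw [hW]; simp
  · simp only [Equiv.apply_symm_apply]
    rcases f j with ⟨x, j⟩ | j
    · simp only [W, Sum.elim_inl]
      split_ifs <;> simp [u2]
    · simp [W]
  · rw [f.sum_comp fun j => |W j (e i)|]
    rcases e i with ⟨x, i⟩ | i
    · simp [W, Fintype.sum_prod_type, apply_ite abs]
      refine (u3 i).trans ?_
      have : (0 : ℝ) ≤ √2 := by positivity
      have : (0 : ℝ) ≤ 1 / √N := by positivity
      nlinarith
    · simp [W, apply_ite abs]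
      have : (0 : ℝ) ≤ √2 := by positivity
      linarith

/-! ### Superposition of analog transmission and a code for the digital transmitters -/

/-- Only the Euclidean norm of the coefficients of `L` enters, and orthonormal rows preserve that
norm. -/
theorem charFunDual_noiseLaw (σ : ℝ) {n : ℕ} (L : StrongDual ℝ (Fin n → ℝ)) :
    charFunDual (noiseLaw σ n) L =
      Complex.exp (-((σ ^ 2 * ∑ i, L (Pi.single i 1) ^ 2 : ℝ) : ℂ) / 2) := by
  have h : ∀ i, charFunDual (gaussianReal 0 (σ ^ 2).toNNReal)
      (L.comp (ContinuousLinearMap.single ℝ (fun _ : Fin n => ℝ) i)) =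
      Complex.exp (-((σ ^ 2 * L (Pi.single i 1) ^ 2 : ℝ) : ℂ) / 2) := by
    intro i
    have e : gaussianReal 0 (σ ^ 2).toNNReal = (gaussianReal 0 (σ ^ 2).toNNReal).map id := by simp
    have hL : ∀ t : ℝ, L.comp (ContinuousLinearMap.single ℝ (fun _ : Fin n => ℝ) i) t =
        t * L (Pi.single i 1) := by
      intro t
      have : (Pi.single i t : Fin n → ℝ) = t • Pi.single i (1 : ℝ) := by
        rw [← Pi.single_smul]; simp
      simp only [ContinuousLinearMap.comp_apply, ContinuousLinearMap.single_apply]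
      rw [this, map_smul, smul_eq_mul]
    have e2 : charFunDual (gaussianReal 0 (σ ^ 2).toNNReal)
        (L.comp (ContinuousLinearMap.single ℝ (fun _ : Fin n => ℝ) i)) =
        charFun (gaussianReal 0 (σ ^ 2).toNNReal) (L (Pi.single i 1)) := by
      rw [charFunDual_apply, charFun_apply_real]
      refine integral_congr_ae (ae_of_all _ fun t => ?_)
      simp only [hL]
      push_cast
      ring_nf
    rw [e2, charFun_gaussianReal, Real.coe_toNNReal _ (sq_nonneg σ)]
    congr 1
    push_cast
    ring
  rw [noiseLaw, charFunDual_pi]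
  simp only [h]
  rw [← Complex.exp_sum]
  congr 1
  push_cast
  rw [Finset.mul_sum, ← Finset.sum_neg_distrib, Finset.sum_div]

/-- Projecting white Gaussian noise on an orthonormal family gives white Gaussian noise. -/
theorem noiseLaw_map_of_orthonormalRows (σ : ℝ) {m n : ℕ} {U : Fin m → Fin n → ℝ}
    (hU : OrthonormalRows U) :
    (noiseLaw σ n).map (fun z j => ∑ i, U j i * z i) = noiseLaw σ m := by
  let T : (Fin n → ℝ) →L[ℝ] (Fin m → ℝ) := (Matrix.toLin' (Matrix.of U)).toContinuousLinearMap
  have hT : (fun (z : Fin n → ℝ) j => ∑ i, U j i * z i) = T := by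
    ext z j
    simp [T, Matrix.mulVec, dotProduct]
  rw [hT]
  have := Measure.isProbabilityMeasure_map (μ := noiseLaw σ n) (f := T) (by fun_prop)
  refine Measure.ext_of_charFunDual (funext fun L => ?_)
  rw [charFunDual_map, charFunDual_noiseLaw, charFunDual_noiseLaw]
  have h1 : ∀ i, (L.comp T) (Pi.single i 1) = ∑ j, L (Pi.single j 1) * U j i := by
    intro i
    have : T (Pi.single i 1) = fun j => U j i := by
      rw [← hT]; ext j; simp [Pi.single_apply]
    rw [ContinuousLinearMap.comp_apply, this]
    have h2 : (fun j => U j i) = ∑ j, U j i • (Pi.single j 1 : Fin m → ℝ) := by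
      ext j; simp [Finset.sum_apply, Pi.single_apply]
    rw [h2, map_sum]
    exact Finset.sum_congr rfl fun j _ => by rw [map_smul, smul_eq_mul, mul_comm]
  simp only [h1, hU.sum_sq_vecMul]

/-- The mean square of the average of `N` noise samples. -/
theorem lintegral_noiseLaw_linear_sq (σ : ℝ) {n : ℕ} (a : Fin n → ℝ) {N : ℝ} (hN : 0 < N)
    (ha : ∑ i, a i * a i = N) (c : ℝ) :
    ∫⁻ z, ENNReal.ofReal ((c * ∑ i, a i * z i) ^ 2) ∂(noiseLaw σ n) =
      ENNReal.ofReal (c ^ 2 * N * σ ^ 2) := by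
  let U : Fin 1 → Fin n → ℝ := fun _ i => (√N)⁻¹ * a i
  have hs : √N * √N = N := Real.mul_self_sqrt hN.le
  have hs0 : √N ≠ 0 := by positivity
  have hU : OrthonormalRows U := by
    intro j j'
    have : ∀ i, U j i * U j' i = (√N * √N)⁻¹ * (a i * a i) := fun i => by
      simp only [U, mul_inv]; ring
    rw [Finset.sum_congr rfl fun i _ => this i, ← Finset.mul_sum, ha, hs,
      inv_mul_cancel₀ hN.ne', if_pos (Subsingleton.elim _ _)]
  have h : ∀ z : Fin n → ℝ, (c * ∑ i, a i * z i) ^ 2 = c ^ 2 * N * (∑ i, U 0 i * z i) ^ 2 := by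
    intro z
    have : ∑ i, U 0 i * z i = (√N)⁻¹ * ∑ i, a i * z i := by
      rw [Finset.mul_sum]; exact Finset.sum_congr rfl fun i _ => by simp only [U]; ring
    rw [this, mul_pow, mul_pow, inv_pow, Real.sq_sqrt hN.le]
    field_simp
  calc _ = ∫⁻ z, ENNReal.ofReal (c ^ 2 * N * ((fun j => ∑ i, U j i * z i) 0) ^ 2)
        ∂(noiseLaw σ n) := by simp only [h]
    _ = ∫⁻ w, ENNReal.ofReal (c ^ 2 * N * w 0 ^ 2) ∂(noiseLaw σ 1) := by
        rw [← noiseLaw_map_of_orthonormalRows σ hU, lintegral_map (by fun_prop) (by fun_prop)]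
    _ = _ := by
        rw [← ofReal_integral_eq_lintegral_ofReal
          ((memLp_noiseLaw_eval σ 0).integrable_sq.const_mul _)
          (ae_of_all _ fun z => by positivity), integral_const_mul, integral_noiseLaw_eval_sq]

/-- Analog values are repeated `N` times at full amplitude; the code is transmitted in the
orthogonal complement of the blocks. -/
noncomputable def superposition {Ka Kd n q N : ℕ} (Aa : ℝ)
    (e : Fin n ≃ (Fin q × Fin N) ⊕ Fin (n - q * N)) (U : Fin (n - q) → Fin n → ℝ)
    (c : MacCode Kd (n - q)) : SoccScheme Ka Kd n where
  L := q
  M := c.M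
  analogEnc _ s i := Sum.elim (fun b => Aa * (s b.1 : ℝ)) 0 (e i)
  measurable_analogEnc _ := measurable_pi_lambda _ fun i => by
    rcases e i with b | b
    · simp only [Sum.elim_inl]; fun_prop
    · exact measurable_const
  digitalEnc k m i := ∑ j, c.enc k m j * U j i
  digitalDec (y : Fin n → ℝ) := c.dec fun j => ∑ i, U j i * y i
  measurable_digitalDec := c.measurable_dec.comp (by fun_prop)
  analogDec (y : Fin n → ℝ) ℓ := (N * Aa)⁻¹ * ∑ t, y (e.symm (Sum.inl (ℓ, t)))
  measurable_analogDec := by fun_prop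

section Superposition

variable {Ka Kd n q N : ℕ} {Aa : ℝ} {e : Fin n ≃ (Fin q × Fin N) ⊕ Fin (n - q * N)}
  {U : Fin (n - q) → Fin n → ℝ} {c : MacCode Kd (n - q)}

/-- Projection on the rows of `U` kills the analog signals, which are constant on blocks, returns
the codewords, and leaves white noise of the same variance. -/
theorem superposition_digitalError (hU : OrthonormalRows U)
    (h0 : ∀ j ℓ, ∑ t, U j (e.symm (Sum.inl (ℓ, t))) = 0) (σ : ℝ)
    (s : Fin Ka → Fin q → Set.Icc (-1 : ℝ) 1) :
    (superposition (Ka := Ka) Aa e U c).digitalError σ s = c.error σ := by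
  unfold SoccScheme.digitalError MacCode.error
  congr 1
  refine Finset.sum_congr rfl fun m _ => ?_
  have hms : MeasurableSet {y | c.dec y ≠ m} :=
    (c.measurable_dec (measurableSet_singleton m)).compl
  have hproj : Measurable fun (y : Fin n → ℝ) j => ∑ i, U j i * y i := by fun_prop
  have hanalog : ∀ (k : Fin Ka) j,
      ∑ i, U j i * Sum.elim (fun b : Fin q × Fin N => Aa * (s k b.1 : ℝ)) 0 (e i) = 0 := by
    intro k j
    rw [← e.symm.sum_comp]
    simp only [Equiv.apply_symm_apply, Fintype.sum_sum_type, Sum.elim_inl, Sum.elim_inr,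
      Fintype.sum_prod_type, Pi.zero_apply, mul_zero, Finset.sum_const_zero, add_zero,
      ← Finset.sum_mul, h0, zero_mul]
  change ((noiseLaw σ n).map _).real ((fun (y : Fin n → ℝ) j => ∑ i, U j i * y i) ⁻¹' {y | c.dec y ≠ m}) = _
  rw [macOutputLaw, ← map_measureReal_apply hproj hms, Measure.map_map hproj (by fun_prop),
    ← noiseLaw_map_of_orthonormalRows σ hU, Measure.map_map (by fun_prop) hproj]
  congr 2
  ext z j
  simp only [Function.comp_apply, Fintype.sum_sum_type, Sum.elim_inl, Sum.elim_inr, superposition,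
    Pi.add_apply, Finset.sum_apply, mul_add, Finset.sum_add_distrib, Finset.mul_sum]
  rw [Finset.sum_comm]
  simp only [hanalog, Finset.sum_const_zero, zero_add]
  rw [Finset.sum_comm]
  simp only [← Finset.mul_sum, hU.mulVec_vecMul]

/-- The peak grows at most by the absolute column sums of `U`, while orthonormality preserves the
energy exactly. -/
theorem superposition_meetsConstraints (hU : OrthonormalRows U)
    (hsum : ∀ i, ∑ j, |U j i| ≤ 2 + √2) (hn : 0 < n) (hAa : 0 ≤ Aa) {P A : Fin Kd → ℝ}
    (hA : ∀ k, 0 ≤ A k)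
    (hcA : ∀ k m j, |c.enc k m j| ≤ A k / (2 + √2))
    (hcP : ∀ k m, ∑ j, c.enc k m j ^ 2 ≤ n * P k) :
    (superposition (Ka := Ka) Aa e U c).MeetsConstraints Aa P A := by
  have hn' : (0 : ℝ) < n := by exact_mod_cast hn
  refine ⟨fun k s => (pi_norm_le_iff_of_nonneg hAa).2 fun i => ?_, fun k m =>
    ⟨(pi_norm_le_iff_of_nonneg (hA k)).2 fun i => ?_, ?_⟩⟩
  · simp only [superposition]
    rcases e i with b | b
    · have h1 : |(s b.1 : ℝ)| ≤ 1 := abs_le.2 (s b.1).2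
      simp only [Sum.elim_inl, Real.norm_eq_abs, abs_mul, abs_of_nonneg hAa]
      nlinarith
    · simpa using hAa
  · have hpos : 0 ≤ A k / (2 + √2) := div_nonneg (hA k) (by positivity)
    calc _ ≤ ∑ j, |c.enc k m j * U j i| := Finset.abs_sum_le_sum_abs _ _
      _ ≤ ∑ j, A k / (2 + √2) * |U j i| := by
          refine Finset.sum_le_sum fun j _ => ?_
          rw [abs_mul]
          gcongr
          exact hcA k m j
      _ ≤ A k / (2 + √2) * (2 + √2) := by
          rw [← Finset.mul_sum]
          gcongr
          exact hsum i
      _ = A k := div_mul_cancel₀ _ (by positivity)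
  · unfold PowerBounded
    rw [one_div, inv_mul_le_iff₀ hn']
    exact (hU.sum_sq_vecMul _).trans_le (hcP k m)

/-- Digital signals cancel in each block sum, so the error is the average of `N` noise samples
divided by `Aa`; its mean square equals the bound. -/
theorem superposition_approximatesSums (hN : 0 < N) (hAa : 0 < Aa)
    (h0 : ∀ j ℓ, ∑ t, U j (e.symm (Sum.inl (ℓ, t))) = 0) (σ : ℝ) :
    (superposition (Ka := Ka) Aa e U c).ApproximatesSums σ (1 / N * σ ^ 2 / Aa ^ 2) := by
  have hN' : (0 : ℝ) < N := by exact_mod_cast hN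
  intro ℓ s m
  change Fin q at ℓ
  let a : Fin n → ℝ := fun i => Sum.elim (fun b : Fin q × Fin N => if ℓ = b.1 then 1 else 0) 0 (e i)
  have hsum : ∀ z : Fin n → ℝ, ∑ i, a i * z i = ∑ t, z (e.symm (Sum.inl (ℓ, t))) := by
    intro z
    rw [← e.symm.sum_comp]
    simp [a, Fintype.sum_sum_type, Fintype.sum_prod_type]
    rw [Finset.sum_comm]
    simp
  have ha : ∑ i, a i * a i = N := by
    rw [hsum]; simp [a]
  rw [SoccScheme.outputLaw, macOutputLaw, lintegral_map ?_ (by fun_prop)]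
  · refine le_of_eq ?_
    calc _ = ∫⁻ z, ENNReal.ofReal ((-(N * Aa)⁻¹ * ∑ i, a i * z i) ^ 2) ∂(noiseLaw σ n) := by
          refine lintegral_congr fun z => ?_
          congr 2
          simp only [superposition, hsum, Fintype.sum_sum_type, Sum.elim_inl, Sum.elim_inr,
            Pi.add_apply, Finset.sum_apply, Finset.sum_add_distrib, Equiv.apply_symm_apply]
          have e1 : ∑ t : Fin N, ∑ k : Fin Ka, Aa * (s k ℓ : ℝ) = N * Aa * ∑ k, (s k ℓ : ℝ) := by
            simp [← Finset.mul_sum, mul_assoc]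
          have e2 : ∑ t, ∑ k, ∑ j, c.enc k (m k) j * U j (e.symm (Sum.inl (ℓ, t))) = 0 := by
            rw [Finset.sum_comm]
            refine Finset.sum_eq_zero fun k _ => ?_
            rw [Finset.sum_comm]
            simp [← Finset.mul_sum, h0]
          rw [e1, e2]
          field_simp
          ring
      _ = _ := by
          rw [lintegral_noiseLaw_linear_sq σ a hN' ha]
          congr 1
          field_simp
  · have := (superposition (Ka := Ka) Aa e U c).measurable_analogDec
    have h2 : Measurable fun y => (superposition (Ka := Ka) Aa e U c).analogDec y ℓ :=
      (measurable_pi_apply ℓ).comp this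
    exact ((h2.const_sub _).pow_const 2).ennreal_ofReal

end Superposition

/-! ### Assembly of the inner bound -/

/-- The scheme in which nobody transmits. -/
noncomputable def silentScheme (Ka Kd n : ℕ) (M : Fin Kd → ℕ) (hM : ∀ k, 0 < M k) :
    SoccScheme Ka Kd n where
  L := n
  M := M
  analogEnc _ _ := 0
  measurable_analogEnc _ := measurable_const
  digitalEnc _ _ := 0
  digitalDec _ k := ⟨0, hM k⟩
  measurable_digitalDec := measurable_const
  analogDec _ _ := 0
  measurable_analogDec := measurable_const

/-- The code with a single message for each transmitter. -/
def trivialCode (K n : ℕ) : MacCode K n where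
  M _ := 1
  enc _ _ := 0
  dec _ _ := 0
  measurable_dec := measurable_const

theorem trivialCode_error (K n : ℕ) (σ : ℝ) : (trivialCode K n).error σ = 0 := by
  have h : ∀ m : (k : Fin K) → Fin ((trivialCode K n).M k),
      {y | (trivialCode K n).dec y ≠ m} = ∅ := fun m =>
    Set.eq_empty_of_forall_notMem fun y hy =>
      hy (funext fun k => Subsingleton.elim (α := Fin 1) _ _)
  simp only [MacCode.error, h, measureReal_empty, Finset.sum_const_zero, mul_zero]

/-- Codes for `n - n / N` channel uses, viewed as codes for `n` channel uses. -/
theorem exists_codes_of_macAchievable {K : ℕ} {σ : ℝ} {P A R : Fin K → ℝ} (hP : ∀ k, 0 ≤ P k)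
    (hA : ∀ k, 0 ≤ A k) (hR : MacAchievable σ P A R) {N : ℕ} (hN : 0 < N) :
    ∃ c : (n : ℕ) → MacCode K (n - n / N),
      (∀ n, 0 < n → ∀ k, (1 - 1 / N) * R k ≤ Real.log ((c n).M k) / n) ∧
      (∀ n k m, ∑ i, (c n).enc k m i ^ 2 ≤ (n - n / N : ℕ) * P k) ∧
      (∀ n k m i, |(c n).enc k m i| ≤ A k) ∧
      Tendsto (fun n => (c n).error σ) atTop (𝓝 0) := by
  obtain ⟨hR0, c, hrate, hcon, herr⟩ := hR
  -- For `N = 1` no channel uses remain for the code, but the rate factor `1 - 1/N` vanishes, so one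
  -- message per transmitter is enough.
  rcases Nat.lt_or_ge N 2 with h | h
  · obtain rfl : N = 1 := by omega
    refine ⟨fun n => trivialCode K _, fun n _ k => ?_, fun n k m => ?_, fun n k m i => ?_, ?_⟩
    · simp [trivialCode]
    · simp only [trivialCode, Pi.zero_apply]
      have := hP k
      simp only [ne_eq, OfNat.ofNat_ne_zero, not_false_eq_true, zero_pow, Finset.sum_const_zero]
      positivity
    · simpa [trivialCode] using hA k
    · simp [trivialCode_error]
  have hlt : ∀ n, 0 < n → 0 < n - n / N := fun n hn => Nat.sub_pos_of_lt (Nat.div_lt_self hn h)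
  refine ⟨fun n => c (n - n / N), fun n hn k => ?_, fun n k m => ?_, fun n k m i => ?_, ?_⟩
  · have h1 := hrate _ (hlt n hn) k
    have hpos : (0 : ℝ) < ((n - n / N : ℕ) : ℝ) := by exact_mod_cast hlt n hn
    have hn' : (0 : ℝ) < n := by exact_mod_cast hn
    rw [le_div_iff₀ hpos] at h1
    rw [le_div_iff₀ hn']
    refine le_trans ?_ h1
    have h2 : (1 - 1 / (N : ℝ)) * n ≤ ((n - n / N : ℕ) : ℝ) := by
      rw [Nat.cast_sub (Nat.div_le_self n N)]
      have : ((n / N : ℕ) : ℝ) ≤ n / N := Nat.cast_div_le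
      have e : (1 - 1 / (N : ℝ)) * n = n - n / N := by ring
      linarith
    nlinarith [hR0 k]
  · rcases Nat.eq_zero_or_pos n with rfl | hn
    · have : IsEmpty (Fin (0 - 0 / N)) := ⟨fun i =>
        Nat.not_lt_zero i.1 (i.2.trans_eq (Nat.zero_sub _))⟩
      simp
    · exact sum_sq_le_of_powerBounded (hlt n hn) (hcon _ (hlt n hn) k m).1
  · have hn : 0 < n - n / N := i.pos
    exact abs_apply_le_of_amplitudeBounded (hcon _ hn k m).2 i
  -- For `N ≥ 2` the shortened length is at least `n / 2`, so it tends to infinity.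
  · refine herr.comp (tendsto_atTop_mono (f := fun n => n / 2) (fun n => ?_)
      (Nat.tendsto_div_const_atTop two_ne_zero))
    have : n / N ≤ n / 2 := Nat.div_le_div_left h two_pos
    omega

theorem soccAchievable_of_macAchievable (Ka : ℕ) {Kd : ℕ} {σ Aa : ℝ} {P A : Fin Kd → ℝ} {β : ℝ}
    (hAa : 0 < Aa) (hP : ∀ k, 0 ≤ P k) (hA : ∀ k, 0 ≤ A k) (hβ1 : β < 1) {N : ℕ}
    (hN : 0 < N) (hβN : β < 1 / N) {R : Fin Kd → ℝ}
    (hR : MacAchievable σ (fun k => P k / (1 - β)) (fun k => A k / (√2 / (√2 - 1))) R) :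
    SoccAchievable Ka σ Aa P A β (1 / N * σ ^ 2 / Aa ^ 2) fun k => (1 - 1 / N) * R k := by
  have hc : √2 / (√2 - 1) = 2 + √2 := by
    have h2 : √2 * √2 = 2 := Real.mul_self_sqrt zero_le_two
    have h1 : √2 - 1 ≠ 0 := by
      intro h
      have : √2 = 1 := by linarith
      rw [this] at h2
      norm_num at h2
    rw [div_eq_iff h1]
    nlinarith
  rw [hc] at hR
  have hN' : (0 : ℝ) < N := by exact_mod_cast hN
  have hNinv : (1 : ℝ) / N ≤ 1 := by
    rw [div_le_one hN']; exact_mod_cast hN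
  have hβ1' : 0 < 1 - β := by linarith
  have hR0 := hR.1
  obtain ⟨c, hrate, hpow, hamp, herr⟩ := exists_codes_of_macAchievable
    (fun k => div_nonneg (hP k) hβ1'.le) (fun k => div_nonneg (hA k) (by positivity)) hR hN
  choose e U hU h0 hsum using fun n : ℕ =>
    exists_blockwise_family (n := n) (q := n / N) hN (Nat.div_mul_le_self n N)
  have hM : ∀ n k, 0 < ⌈Real.exp (n * ((1 - 1 / N) * R k))⌉₊ := fun n k =>
    Nat.ceil_pos.2 (Real.exp_pos _)
  -- Rounding down can make `n / N` blocks too few for analog rate `β`, though only for finitely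
  -- many `n` since `β < 1/N`. Rates and constraints are required there too but accuracy is not, so
  -- a silent scheme with nominal message sets fills the gap.
  let S : (n : ℕ) → SoccScheme Ka Kd n := fun n =>
    if β * n ≤ (n / N : ℕ) then superposition Aa (e n) (U n) (c n)
    else silentScheme Ka Kd n (fun k => ⌈Real.exp (n * ((1 - 1 / N) * R k))⌉₊) (hM n)
  have hlarge : ∀ᶠ n : ℕ in atTop, S n = superposition Aa (e n) (U n) (c n) := by
    obtain ⟨n₀, hn₀⟩ := exists_nat_ge (1 / (1 / N - β))
    filter_upwards [eventually_ge_atTop n₀] with n hn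
    refine if_pos ?_
    have h1 : 1 / (1 / N - β) ≤ (n : ℝ) := hn₀.trans (by exact_mod_cast hn)
    rw [div_le_iff₀ (by linarith)] at h1
    have h2 : (n : ℝ) / N < (n / N : ℕ) + 1 := by
      rw [div_lt_iff₀' hN']
      exact_mod_cast Nat.lt_mul_div_succ n hN
    have e1 : (n : ℝ) * (1 / N - β) = n / N - β * n := by ring
    linarith
  refine ⟨fun k => mul_nonneg (by linarith) (hR0 k), S, fun n hn k => ?_, fun n hn => ?_,
    fun n hn => ?_, fun ε hε => ?_, ?_⟩
  · have hn' : (0 : ℝ) < n := by exact_mod_cast hn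
    by_cases hbig : β * n ≤ (n / N : ℕ)
    · simp only [S, if_pos hbig]
      exact hrate n hn k
    · simp only [S, if_neg hbig, silentScheme]
      rw [le_div_iff₀ hn', Real.le_log_iff_exp_le (by exact_mod_cast hM n k), mul_comm]
      exact Nat.le_ceil _
  · have hn' : (0 : ℝ) < n := by exact_mod_cast hn
    rw [le_div_iff₀ hn']
    by_cases hbig : β * n ≤ (n / N : ℕ)
    · simp only [S, if_pos hbig]
      exact hbig
    · simp only [S, if_neg hbig, silentScheme]
      nlinarith
  · have hn' : (0 : ℝ) < n := by exact_mod_cast hn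
    by_cases hbig : β * n ≤ (n / N : ℕ)
    · simp only [S, if_pos hbig]
      refine superposition_meetsConstraints (hU n) (hsum n) hn hAa.le hA (hamp n)
        fun k m => (hpow n k m).trans ?_
      -- The codeword occupies at most `n (1 - β)` dimensions, so power `P k / (1 - β)` per
      -- dimension costs at most `n * P k` in total.
      have hle : ((n - n / N : ℕ) : ℝ) ≤ n * (1 - β) := by
        rw [Nat.cast_sub (Nat.div_le_self n N)]
        linarith
      calc _ ≤ n * (1 - β) * (P k / (1 - β)) := by
            gcongr
            exact div_nonneg (hP k) hβ1'.le
        _ = n * P k := by field_simp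
    · simp only [S, if_neg hbig]
      refine ⟨fun k s => ?_, fun k m => ⟨?_, ?_⟩⟩
      · simpa [AmplitudeBounded, silentScheme] using hAa.le
      · simpa [AmplitudeBounded, silentScheme] using hA k
      · simpa [PowerBounded, silentScheme] using hP k
  · filter_upwards [hlarge, herr.eventually_le_const hε] with n hn hle
    rw [hn]
    intro s
    exact (superposition_digitalError (hU n) (h0 n) σ s).trans_le hle
  · filter_upwards [hlarge] with n hn
    rw [hn]
    exact superposition_approximatesSums hN hAa (h0 n) σ

theorem theorem1 (Ka Kd : ℕ) (σ Aa : ℝ) (P A : Fin Kd → ℝ) (β β' : ℝ)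
    (hσ : 0 < σ) (hAa : 0 < Aa) (hP : ∀ k, 0 < P k) (hA : ∀ k, 0 < A k)
    (hβ0 : 0 < β) (hβ1 : β < 1)
    (hβ' : IsLeast {x : ℝ | ∃ n : ℕ, 0 < n ∧ x = 1 / (n : ℝ) ∧ β < x} β') :
    soccInner σ P A β β' ⊆ soccCapacity Ka σ Aa P A β (β' * σ ^ 2 / Aa ^ 2) ∧
    soccCapacity Ka σ Aa P A β (β' * σ ^ 2 / Aa ^ 2) ⊆
      soccOuter Ka σ Aa P β (β' * σ ^ 2 / Aa ^ 2) := by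
  obtain ⟨N, hN, rfl, hβN⟩ := hβ'.1
  have hN' : (0 : ℝ) < N := by exact_mod_cast hN
  refine ⟨?_, soccCapacity_subset_soccOuter Ka hσ hAa.le (fun k => (hP k).le) hβ0.le
    (by positivity)⟩
  rintro R ⟨R', hR', hR⟩
  obtain rfl : R = fun k => (1 - 1 / (N : ℝ)) * R' k := funext hR
  -- Scaling is continuous, so achievability of scaled achievable tuples passes to the closures.
  exact map_mem_closure (f := fun (R : Fin Kd → ℝ) k => (1 - 1 / (N : ℝ)) * R k) (by fun_prop) hR'
    fun r hr => soccAchievable_of_macAchievable Ka hAa (fun k => (hP k).le) (fun k => (hA k).le)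
      hβ1 hN hβN hr
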